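/- **Setting.** Let $\sigma$ be a finite relational signature; for $n\ge 1$ let $\mathbf W_n$ be the set of all $\sigma$-structures with domain $[n]=\{1,\dots,n\}$. Let $[0,1]^{<\omega}=\bigcup_{n\ge1}[0,1]^n$. A ($k$-ary, $k\ge 1$) *aggregation function* is a map $F:([0,1]^{<\omega})^k\to[0,1]$ that is invariant under reordering the entries of each of its arguments. A sequence $\bar r_n\in[0,1]^{<\omega}$ ($n\in\mathbb N$) is *convergence testing* for parameters $c_1,\dots,c_t\in[0,1]$ and $\alpha_1,\dots,\alpha_t\in[0,1]$ if the lengths $|\bar r_n|$ are strictly increasing and, for all pairwise disjoint intervals $I_1,\dots,I_t$, relatively open in $[0,1]$, with $c_j\in I_j$, for all large $n$ all entries of $\bar r_n$ lie in $\bigcup_j I_j$, and for each $j$ the proportion of entries of $\bar r_n$ lying in $I_j$ tends to $\alpha_j$. $F$ is *admissible* if (1) $F$ is continuous on $[0,1]^{n_1}\times\dots\times[0,1]^{n_k}$ for all $n_1,\dots,n_k\ge1$, and (2) $|F(\bar r_{1,n},\dots,\bar r_{k,n})-F(\bar\rho_{1,n},\dots,\bar\rho_{k,n})|\to0$ whenever,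 for each $i$, $(\bar r_{i,n})_n$ and $(\bar\rho_{i,n})_n$ are convergence testing for the same parameters $c_{i,1},\dots,c_{i,m_i}\in[0,1]$ (pairwise distinct) and $\alpha_{i,1},\dots,\alpha_{i,m_i}\in(0,1]$, with $m_i\ge 1$. The formulas of $PLA(\sigma)$ are built from constants $c\in[0,1]$ and atoms $x=y$, $R(x_1,\dots,x_r)$ ($R\in\sigma$ of arity $r$) by $\neg\varphi$, $\varphi\wedge\psi$, $\varphi\vee\psi$, $\varphi\to\psi$, the weighted mean $\varphi\psi+(1-\varphi)\chi$, and $$F(\varphi_1(\bar x,\bar y),\dots,\varphi_k(\bar x,\bar y):\bar y:p^=(\bar x,\bar y)),$$ which binds $\bar y$; here $\bar x,\bar y$ are sequences of distinct variables with no variable in common, the free variables of every $\varphi_i$ are among $\bar x\bar y$, $F$ is a $k$-ary aggregation function and $p^=$ is a complete consistent description of the equalities and inequalities between the variables $\bar x\bar y$. The value $\mathcal A(\varphi(\bar a))\in[0,1]$ in a finite structure $\mathcal A$ with domain $A$ is: $c$ for a constant $c$; $1$ or $0$ for true or false atoms; $1-u$, $\min(u,v)$, $\max(u,v)$, $\min(1,1-u+v)$,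 $uv+(1-u)w$ for the connectives above, where $u,v,w$ are the values of $\varphi,\psi,\chi$; and $F(\bar r_1,\dots,\bar r_k)$ for the last construction, where $\bar r_i=(\mathcal A(\varphi_i(\bar a,\bar b)):\bar b\in A^{|\bar y|},\ p^=(\bar a,\bar b)\text{ holds})$. If there is no such $\bar b$, the value is a number $e\in[0,1]$, fixed once and for all; the result holds for every choice of $e$. A *$PLA(\sigma)$-network* $\mathbb G$ consists of a directed acyclic graph with vertex set $\sigma$ and, for each $R\in\sigma$, a formula $\theta_R(\bar x)\in PLA(\mathrm{par}(R))$, where $\mathrm{par}(R)$ is the set of parents of $R$ and $|\bar x|$ is the arity $k_R$ of $R$. It induces on each $\mathbf W_n$ the probability distribution $$\mathbb P_n(\mathcal A)=\prod_{R\in\sigma}\ \prod_{\bar a\in R^{\mathcal A}}\mathcal A(\theta_R(\bar a))\prod_{\bar a\in[n]^{k_R}\setminus R^{\mathcal A}}\bigl(1-\mathcal A(\theta_R(\bar a))\bigr).$$ **Corollary (Convergence of probability).** Let $\mathbb G$ be a $PLA(\sigma)$-network in which no formula $\theta_R$ contains an aggregation function, and let $\varphi(\bar x)\in PLA(\sigma)$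 be a formula all of whose aggregation functions are admissible. Then there are $c_1,\dots,c_k\in[0,1]$, depending only on $\varphi$ and $\mathbb G$ (and on the convention $e$), such that for every $m\ge1$, every $\bar a\in[m]^{|\bar x|}$ and every $\varepsilon>0$: 1. $\displaystyle\lim_{n\to\infty}\mathbb P_n\Bigl(\Bigl\{\mathcal A\in\mathbf W_n:\mathcal A(\varphi(\bar a))\in\bigcup_{i=1}^k[c_i-\varepsilon,c_i+\varepsilon]\Bigr\}\Bigr)=1$; 2. for every $i\in\{1,\dots,k\}$ such that $\varepsilon\ne|c_i-c_j|$ for all $j$, the probability $\mathbb P_n(\{\mathcal A\in\mathbf W_n:|\mathcal A(\varphi(\bar a))-c_i|<\varepsilon\})$ converges as $n\to\infty$. -/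

import Mathlib

open Filter Topology

namespace PLA

universe u

/-! ## Aggregation functions and admissibility -/

/-- Nonempty finite sequences of reals in the unit interval, `[0,1]^{<ω} = ⋃_{n ≥ 1} [0,1]^n`. -/
abbrev UnitSeq : Type := {l : List unitInterval // l ≠ []}

/-- A `k`-ary aggregation function: a function `([0,1]^{<ω})^k → [0,1]` which is invariant under
reordering the entries of each of its arguments. -/
structure AggFun (k : ℕ) where
  toFun : (Fin k → UnitSeq) → unitInterval
  symmetric : ∀ r ρ : Fin k → UnitSeq, (∀ i, (r i).1.Perm (ρ i).1) → toFun r = toFun ρ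

/-- A tuple in `[0,1]^(n+1)` as a nonempty sequence. -/
def UnitSeq.ofFn {n : ℕ} (v : Fin (n + 1) → unitInterval) : UnitSeq :=
  ⟨List.ofFn v, by simp⟩

open Classical in
/-- The sequence of sequences `r` is convergence testing for the parameters `c`, `α`.
Intervals are open relative to `[0,1]` (so that they may contain `0` or `1`). -/
def ConvergenceTesting (r : ℕ → UnitSeq) {t : ℕ} (c α : Fin t → unitInterval) : Prop :=
  (∀ n, (r n).1.length < (r (n + 1)).1.length) ∧
  ∀ I : Fin t → Set unitInterval,
    (∀ j, IsOpen (I j)) → (∀ j, (I j).OrdConnected) →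
    (∀ j j', j ≠ j' → Disjoint (I j) (I j')) → (∀ j, c j ∈ I j) →
    (∃ N, ∀ n ≥ N, ∀ x ∈ (r n).1, ∃ j, x ∈ I j) ∧
    ∀ j, Tendsto (fun n => ((r n).1.countP (fun x => x ∈ I j) : ℝ) / ((r n).1.length : ℝ))
      atTop (𝓝 (α j : ℝ))

/-- Admissible aggregation functions. For each `i` the limit points `c i 1, c i 2, …` are pairwise
distinct (for repeated points there is no disjoint family of intervals around them). -/
def AggFun.Admissible {k : ℕ} (F : AggFun k) : Prop :=
  (∀ n : Fin k → ℕ,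
    Continuous (fun v : (i : Fin k) → (Fin (n i + 1) → unitInterval) =>
      F.toFun (fun i => UnitSeq.ofFn (v i)))) ∧
  ∀ (t : Fin k → ℕ) (c α : (i : Fin k) → Fin (t i) → unitInterval),
    (∀ i, 0 < t i) → (∀ i, Function.Injective (c i)) → (∀ i j, 0 < α i j) →
    ∀ r ρ : ℕ → Fin k → UnitSeq,
      (∀ i, ConvergenceTesting (fun n => r n i) (c i) (α i)) →
      (∀ i, ConvergenceTesting (fun n => ρ n i) (c i) (α i)) →
      Tendsto (fun n => |(F.toFun (r n) : ℝ) - (F.toFun (ρ n) : ℝ)|) atTop (𝓝 0)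

/-! ## Syntax -/

/-- Formulas of probability logic with aggregation functions, over the relational signature with
set of relation symbols `ι` and arities `ar`. `Formula ar n` consists of the formulas
`φ(x̄)` for a sequence `x̄` of `n` distinct variables, referred to by their position.

In `agg`, `x` selects a sequence `x̄` of `l` distinct variables among the `n` available ones,
`m` fresh variables `ȳ` are bound, the formulas `φ i` have their free variables among `x̄ȳ`
(`x̄` first, then `ȳ`), and `p` is a complete description of the equalities and nonequalities
between the variables `x̄ȳ`, that is, an equivalence relation on the `l + m` positions. -/
inductive Formula {ι : Type u} (ar : ι → ℕ) : ℕ → Type u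
  | const {n : ℕ} (c : unitInterval) : Formula ar n
  | eq {n : ℕ} (i j : Fin n) : Formula ar n
  | rel {n : ℕ} (R : ι) (v : Fin (ar R) → Fin n) : Formula ar n
  | neg {n : ℕ} (φ : Formula ar n) : Formula ar n
  | and {n : ℕ} (φ ψ : Formula ar n) : Formula ar n
  | or {n : ℕ} (φ ψ : Formula ar n) : Formula ar n
  | imp {n : ℕ} (φ ψ : Formula ar n) : Formula ar n
  | mean {n : ℕ} (φ ψ χ : Formula ar n) : Formula ar n
  | agg {n l m k : ℕ} (hk : 0 < k) (F : AggFun k) (x : Fin l ↪ Fin n)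
      (p : Setoid (Fin (l + m))) (φ : Fin k → Formula ar (l + m)) : Formula ar n

namespace Formula

variable {ι : Type u} {ar : ι → ℕ}

/-- No aggregation function occurs in the formula. -/
def AggFree : {n : ℕ} → Formula ar n → Prop
  | _, const _ => True
  | _, eq _ _ => True
  | _, rel _ _ => True
  | _, neg φ => φ.AggFree
  | _, and φ ψ => φ.AggFree ∧ ψ.AggFree
  | _, or φ ψ => φ.AggFree ∧ ψ.AggFree
  | _, imp φ ψ => φ.AggFree ∧ ψ.AggFree
  | _, mean φ ψ χ => φ.AggFree ∧ ψ.AggFree ∧ χ.AggFree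
  | _, agg _ _ _ _ _ => False

/-- Every aggregation function that occurs in the formula is admissible. -/
def OnlyAdmissible : {n : ℕ} → Formula ar n → Prop
  | _, const _ => True
  | _, eq _ _ => True
  | _, rel _ _ => True
  | _, neg φ => φ.OnlyAdmissible
  | _, and φ ψ => φ.OnlyAdmissible ∧ ψ.OnlyAdmissible
  | _, or φ ψ => φ.OnlyAdmissible ∧ ψ.OnlyAdmissible
  | _, imp φ ψ => φ.OnlyAdmissible ∧ ψ.OnlyAdmissible
  | _, mean φ ψ χ => φ.OnlyAdmissible ∧ ψ.OnlyAdmissible ∧ χ.OnlyAdmissible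
  | _, agg _ F _ _ φ => F.Admissible ∧ ∀ i, (φ i).OnlyAdmissible

end Formula

/-! ## Semantics -/

/-- Structures with domain `D` for the relational signature `ar`. -/
abbrev Struct {ι : Type u} (ar : ι → ℕ) (D : Type) : Type u :=
  (R : ι) → (Fin (ar R) → D) → Prop

/-- Łukasiewicz implication on the unit interval. -/
noncomputable def lukImp (a b : unitInterval) : unitInterval :=
  ⟨min 1 (1 - (a : ℝ) + b), by
    have := a.2.2; have := b.2.1
    exact le_min zero_le_one (by linarith), min_le_left _ _⟩

/-- The `a`-weighted mean `a b + (1 - a) c` on the unit interval. -/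
noncomputable def wMean (a b c : unitInterval) : unitInterval :=
  ⟨(a : ℝ) * b + (1 - (a : ℝ)) * c, by
    have h1 := a.2.1; have h2 := a.2.2
    have h3 := b.2.1; have h4 := b.2.2; have h5 := c.2.1; have h6 := c.2.2
    constructor
    · have := mul_nonneg h1 h3
      have := mul_nonneg (sub_nonneg.2 h2) h5
      linarith
    · nlinarith [mul_nonneg h1 (sub_nonneg.2 h4), mul_nonneg (sub_nonneg.2 h2) (sub_nonneg.2 h6)]⟩

open Classical in
/-- The tuples `b̄` in the domain for which `p(ā, b̄)` holds. -/
noncomputable def realizers {D : Type} [Fintype D] {l m : ℕ} (p : Setoid (Fin (l + m)))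
    (a : Fin l → D) : Finset (Fin m → D) :=
  Finset.univ.filter fun b =>
    ∀ i j, Fin.append a b i = Fin.append a b j ↔ p i j

open Classical in
/-- The value of `φ(ā)` in the finite structure `A`. The number `e` is the value of an aggregation
over the empty family (aggregation functions are defined on nonempty sequences only). -/
noncomputable def Formula.value {ι : Type u} {ar : ι → ℕ} {D : Type} [Fintype D]
    (e : unitInterval) (A : Struct ar D) : {n : ℕ} → Formula ar n → (Fin n → D) → unitInterval
  | _, .const c, _ => c
  | _, .eq i j, a => if a i = a j then 1 else 0
  | _, .rel R v, a => if A R (fun i => a (v i)) then 1 else 0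
  | _, .neg φ, a => unitInterval.symm (φ.value e A a)
  | _, .and φ ψ, a => min (φ.value e A a) (ψ.value e A a)
  | _, .or φ ψ, a => max (φ.value e A a) (ψ.value e A a)
  | _, .imp φ ψ, a => lukImp (φ.value e A a) (ψ.value e A a)
  | _, .mean φ ψ χ, a => wMean (φ.value e A a) (ψ.value e A a) (χ.value e A a)
  | _, .agg _ F x p φ, a =>
      if h : (realizers p (fun i => a (x i))).Nonempty then
        F.toFun fun i =>
          ⟨(realizers p (fun i => a (x i))).toList.map
              (fun b => (φ i).value e A (Fin.append (fun i => a (x i)) b)), by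
            simpa [List.map_eq_nil_iff, Finset.toList_eq_nil] using h.ne_empty⟩
      else e

/-! ## Networks and the induced probability distributions -/

/-- A network over the signature: a directed acyclic graph on the relation symbols (`edge S R`
means that `S` is a parent of `R`) and, for each relation symbol `R`, a formula `θ_R(x̄)` over the
signature consisting of the parents of `R`, where `x̄` has length the arity of `R`. -/
structure Network {ι : Type u} (ar : ι → ℕ) where
  edge : ι → ι → Prop
  acyclic : ∀ R, ¬ Relation.TransGen edge R R
  formula : (R : ι) → Formula (fun S : {S : ι // edge S R} => ar S) (ar R)

namespace Network

variable {ι : Type u} {ar : ι → ℕ}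

/-- The value of `θ_R(ā)` in `A` (that is, in the reduct of `A` to the parents of `R`). -/
noncomputable def condProb (G : Network ar) {D : Type} [Fintype D] (e : unitInterval)
    (A : Struct ar D) (R : ι) (a : Fin (ar R) → D) : ℝ :=
  ((G.formula R).value e (fun S : {S : ι // G.edge S R} => A S) a : ℝ)

open Classical in
/-- The probability of the structure `A`. As the formula of `R` only uses parents of `R`, all of
which have smaller rank in the graph, this is the recursion on the rank of relation symbols,
written as one product. -/
noncomputable def weight [Fintype ι] (G : Network ar) {D : Type} [Fintype D] (e : unitInterval)
    (A : Struct ar D) : ℝ :=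
  ∏ R : ι, ∏ a : Fin (ar R) → D,
    if A R a then G.condProb e A R a else 1 - G.condProb e A R a

open Classical in
/-- The probability `ℙ_n(X)` of a set `X` of structures with domain of size `n`. -/
noncomputable def prob [Fintype ι] (G : Network ar) (e : unitInterval) (n : ℕ)
    (X : Set (Struct ar (Fin n))) : ℝ :=
  ∑ A : Struct ar (Fin n), if A ∈ X then G.weight e A else 0

end Network

end PLA

namespace PLA

universe u

/-! ### Sequential sampling of dependent binary cells. -/

section Chain

open Classical

variable {C : Type*}

/-- Averages over the value of the cell `c`, which is true with probability `w c A`. -/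
noncomputable def step (w : C → (C → Prop) → ℝ) (c : C) (f : (C → Prop) → ℝ) : (C → Prop) → ℝ :=
  fun A => w c A * f (Function.update A c True) + (1 - w c A) * f (Function.update A c False)

/-- Averages over the values of the cells in a list, of which the first is sampled first. -/
noncomputable def run (w : C → (C → Prop) → ℝ) : List C → ((C → Prop) → ℝ) → (C → Prop) → ℝ
  | [], f => f
  | c :: L, f => step w c (run w L f)

/-- The probability of the value of the cell `c` in `B`, given the other cells. -/
noncomputable def cellWeight (w : C → (C → Prop) → ℝ) (c : C) (B : C → Prop) : ℝ :=
  if B c then w c B else 1 - w c B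

variable {w : C → (C → Prop) → ℝ} {dep : C → Set C}

theorem run_append (L L' : List C) (f : (C → Prop) → ℝ) :
    run w (L ++ L') f = run w L (run w L' f) := by
  induction L with
  | nil => rfl
  | cons c L ih => simp [run, ih]

theorem step_mono (h0 : ∀ c A, 0 ≤ w c A) (h1 : ∀ c A, w c A ≤ 1) (c : C)
    {f g : (C → Prop) → ℝ} (h : f ≤ g) : step w c f ≤ step w c g := fun A =>
  add_le_add (mul_le_mul_of_nonneg_left (h _) (h0 c A))
    (mul_le_mul_of_nonneg_left (h _) (sub_nonneg.2 (h1 c A)))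

theorem run_mono (h0 : ∀ c A, 0 ≤ w c A) (h1 : ∀ c A, w c A ≤ 1) (L : List C)
    {f g : (C → Prop) → ℝ} (h : f ≤ g) : run w L f ≤ run w L g := by
  induction L with
  | nil => exact h
  | cons c L ih => exact step_mono h0 h1 c ih

theorem run_add (L : List C) (f g : (C → Prop) → ℝ) :
    run w L (fun A => f A + g A) = fun A => run w L f A + run w L g A := by
  induction L with
  | nil => rfl
  | cons c L ih => funext A; simp only [run, step, ih]; ring

theorem update_apply_of_notMem {β : Type*} {f : (C → Prop) → β} {S : Set C} (hf : DependsOn f S)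
    {c : C} (hc : c ∉ S) (A : C → Prop) (v : Prop) : f (Function.update A c v) = f A :=
  hf fun i hi => by rw [Function.update_of_ne]; rintro rfl; exact hc hi

/-- No update along `L` changes `g`, so it comes out like a constant: the analogue of taking a known
factor out of a conditional expectation. -/
theorem run_mul_left (L : List C) {g : (C → Prop) → ℝ} {S : Set C} (hg : DependsOn g S)
    (hL : ∀ c ∈ L, c ∉ S) (f : (C → Prop) → ℝ) :
    run w L (fun A => g A * f A) = fun A => g A * run w L f A := by
  induction L with
  | nil => rfl
  | cons c L ih =>
    funext A
    simp only [run, step, ih fun c hc => hL c (List.mem_cons_of_mem _ hc),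
      update_apply_of_notMem hg (hL c List.mem_cons_self)]
    ring

theorem run_one (L : List C) : run w L (fun _ => 1) = fun _ => 1 := by
  induction L with
  | nil => rfl
  | cons c L ih => funext A; simp [run, step, ih]

theorem run_of_dependsOn (L : List C) {g : (C → Prop) → ℝ} {S : Set C} (hg : DependsOn g S)
    (hL : ∀ c ∈ L, c ∉ S) : run w L g = g := by
  have := run_mul_left (w := w) L hg hL (fun _ => 1)
  simpa [run_one] using this

theorem run_const (L : List C) (r : ℝ) : run w L (fun _ => r) = fun _ => r :=
  run_of_dependsOn (S := ∅) L (fun _ _ _ => rfl) (by simp)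

theorem run_const_mul (L : List C) (r : ℝ) (f : (C → Prop) → ℝ) :
    run w L (fun A => r * f A) = fun A => r * run w L f A :=
  run_mul_left (g := fun _ => r) (S := ∅) L (fun _ _ _ => rfl) (by simp) f

/-- For `c` in `S` the weight looks only at `dep c ⊆ S`; for `c` outside `S` both branches agree and
`step` does nothing. -/
theorem dependsOn_step (hw : ∀ c, DependsOn (w c) (dep c)) {S : Set C} {c : C}
    (hc : c ∈ S → dep c ⊆ S) {f : (C → Prop) → ℝ} (hf : DependsOn f S) :
    DependsOn (step w c f) S := by
  by_cases h : c ∈ S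
  · intro A B hAB
    have hw' : w c A = w c B := hw c fun i hi => hAB i (hc h hi)
    have key : ∀ v, f (Function.update A c v) = f (Function.update B c v) := fun v =>
      hf fun i hi => by
        by_cases hic : i = c
        · subst hic; simp
        · simp [Function.update_of_ne hic, hAB i hi]
    simp only [step, hw', key]
  · intro A B hAB
    have : ∀ A, step w c f A = f A := fun A => by
      simp only [step, update_apply_of_notMem hf h]; ring
    rw [this, this, hf hAB]

theorem dependsOn_run (hw : ∀ c, DependsOn (w c) (dep c)) {S : Set C} (L : List C)
    (hL : ∀ c ∈ L, c ∈ S → dep c ⊆ S) {f : (C → Prop) → ℝ} (hf : DependsOn f S) :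
    DependsOn (run w L f) S := by
  induction L with
  | nil => exact hf
  | cons c L ih =>
    exact dependsOn_step hw (hL c List.mem_cons_self)
      (ih fun c hc => hL c (List.mem_cons_of_mem _ hc))

theorem step_of_dependsOn {S : Set C} {c : C} (hc : c ∉ S) {f : (C → Prop) → ℝ}
    (hf : DependsOn f S) : step w c f = f :=
  run_of_dependsOn (w := w) [c] hf (by simpa using hc)

theorem run_filter (hw : ∀ c, DependsOn (w c) (dep c)) {S : Set C} (L : List C)
    (hL : ∀ c ∈ L, c ∈ S → dep c ⊆ S) {f : (C → Prop) → ℝ} (hf : DependsOn f S) :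
    run w (L.filter (· ∈ S)) f = run w L f := by
  induction L with
  | nil => rfl
  | cons c L ih =>
    have hL' : ∀ c ∈ L, c ∈ S → dep c ⊆ S := fun c hc => hL c (List.mem_cons_of_mem _ hc)
    by_cases h : c ∈ S
    · simp [h, run, ih hL']
    · simp only [h, decide_false, Bool.false_eq_true, not_false_eq_true, List.filter_cons_of_neg,
        run]
      rw [ih hL', step_of_dependsOn h (dependsOn_run hw L hL' hf)]

/-- Functions of disjoint families of cells, closed under dependence up to the cells which have
already been sampled, are independent. -/
theorem run_prod (hw : ∀ c, DependsOn (w c) (dep c)) {β : Type*} (s : Finset β) (S : β → Set C)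
    (L : List C) (hL : ∀ c ∈ L, ∀ b, c ∈ S b → dep c ⊆ S b)
    (hdisj : ∀ c ∈ L, ∀ b b', c ∈ S b → c ∈ S b' → b = b')
    (f : β → (C → Prop) → ℝ) (hf : ∀ b, DependsOn (f b) (S b)) :
    run w L (fun A => ∏ b ∈ s, f b A) = fun A => ∏ b ∈ s, run w L (f b) A := by
  induction L with
  | nil => rfl
  | cons c L ih =>
    have hL' : ∀ c ∈ L, ∀ b, c ∈ S b → dep c ⊆ S b := fun c hc => hL c (List.mem_cons_of_mem _ hc)
    have hdep : ∀ b, DependsOn (run w L (f b)) (S b) := fun b =>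
      dependsOn_run hw L (fun c hc => hL' c hc b) (hf b)
    simp only [run, ih hL' fun c hc => hdisj c (List.mem_cons_of_mem _ hc)]
    -- By disjointness at most one factor involves `c`; the others pass through `step` unchanged.
    by_cases h : ∃ b ∈ s, c ∈ S b
    · obtain ⟨b, hb, hcb⟩ := h
      have hne : ∀ b' ∈ s.erase b, c ∉ S b' := fun b' hb' hc' =>
        (Finset.ne_of_mem_erase hb') (hdisj c List.mem_cons_self b' b hc' hcb)
      funext A
      simp only [← Finset.mul_prod_erase s _ hb]
      have h1 : ∀ B v, ∏ b' ∈ s.erase b, run w L (f b') (Function.update B c v) =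
          ∏ b' ∈ s.erase b, run w L (f b') B := fun B v =>
        Finset.prod_congr rfl fun b' hb' => update_apply_of_notMem (hdep b') (hne b' hb') B v
      have h2 : ∏ b' ∈ s.erase b, step w c (run w L (f b')) A =
          ∏ b' ∈ s.erase b, run w L (f b') A :=
        Finset.prod_congr rfl fun b' hb' => by rw [step_of_dependsOn (hne b' hb') (hdep b')]
      rw [h2]
      simp only [step, h1]
      ring
    · push Not at h
      funext A
      have h1 : ∀ B v, ∏ b' ∈ s, run w L (f b') (Function.update B c v) =
          ∏ b' ∈ s, run w L (f b') B := fun B v =>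
        Finset.prod_congr rfl fun b' hb' => update_apply_of_notMem (hdep b') (h b' hb') B v
      have h2 : ∏ b' ∈ s, step w c (run w L (f b')) A = ∏ b' ∈ s, run w L (f b') A :=
        Finset.prod_congr rfl fun b' hb' => by rw [step_of_dependsOn (h b' hb') (hdep b')]
      rw [h2]
      simp only [step, h1]
      ring

/-- A list of distinct cells in which no cell depends on itself or on a later one. -/
def Topological (dep : C → Set C) (L : List C) : Prop :=
  L.Nodup ∧ L.Pairwise (fun c c' => c' ∉ dep c) ∧ ∀ c ∈ L, c ∉ dep c

/-- When `c` is sampled, every cell it depends on is already final, so its weight may be evaluated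
at the outcome `B`. The resulting product does not see the order of `L`, which is what makes
reordering possible. -/
theorem run_eq_sum [Fintype C] (hw : ∀ c, DependsOn (w c) (dep c)) (L : List C)
    (hL : Topological dep L) (f : (C → Prop) → ℝ) (A : C → Prop) :
    run w L f A = ∑ B : C → Prop, if ∀ c, c ∉ L → B c = A c then
      f B * (L.map fun c => cellWeight w c B).prod else 0 := by
  induction L generalizing A with
  | nil =>
    have : ∀ B : C → Prop, (∀ c, c ∉ ([] : List C) → B c = A c) ↔ B = A := fun B => by
      simp [funext_iff]
    simp only [run, this, List.map_nil, List.prod_nil, mul_one]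
    rw [Finset.sum_eq_single A (fun B _ hB => if_neg hB) (by simp), if_pos rfl]
  | cons c L ih =>
    obtain ⟨h1, h2, h3⟩ := hL
    rw [List.nodup_cons] at h1
    rw [List.pairwise_cons] at h2
    have ih := ih ⟨h1.2, h2.2, fun c hc => h3 c (List.mem_cons_of_mem _ hc)⟩
    simp only [run, step, ih, Finset.mul_sum, ← Finset.sum_add_distrib]
    refine Finset.sum_congr rfl fun B _ => ?_
    have hupd : ∀ v : Prop, (∀ c', c' ∉ L → B c' = Function.update A c v c') ↔
        (∀ c', c' ∉ c :: L → B c' = A c') ∧ B c = v := by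
      intro v
      constructor
      · intro h
        refine ⟨fun c' hc' => ?_, by simpa using h c h1.1⟩
        have := h c' fun hm => hc' (List.mem_cons_of_mem _ hm)
        rwa [Function.update_of_ne (by rintro rfl; simp at hc')] at this
      · rintro ⟨h, hv⟩ c' hc'
        by_cases hcc : c' = c
        · subst hcc; simpa using hv
        · rw [Function.update_of_ne hcc]; exact h c' (by simp [hcc, hc'])
    simp only [hupd]
    by_cases hB : ∀ c', c' ∉ c :: L → B c' = A c'
    · have hwB : w c B = w c A := hw c fun i hi => hB i fun hm => by
        rcases List.mem_cons.1 hm with rfl | hm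
        · exact h3 i List.mem_cons_self hi
        · exact h2.1 i hm hi
      rw [if_pos hB]
      by_cases hv : B c
      · rw [if_pos ⟨hB, eq_true hv⟩, if_neg fun h => h.2.mp hv, List.map_cons, List.prod_cons,
          cellWeight, if_pos hv, hwB]
        ring
      · rw [if_neg fun h => hv (h.2.mpr trivial), if_pos ⟨hB, eq_false hv⟩, List.map_cons,
          List.prod_cons, cellWeight, if_neg hv, hwB]
        ring
    · rw [if_neg hB, if_neg fun h => hB h.1, if_neg fun h => hB h.1]
      simp

theorem run_congr_list [Fintype C] (hw : ∀ c, DependsOn (w c) (dep c)) {L L' : List C}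
    (hL : Topological dep L) (hL' : Topological dep L') (h : ∀ c, c ∈ L ↔ c ∈ L')
    (f : (C → Prop) → ℝ) : run w L f = run w L' f := by
  funext A
  rw [run_eq_sum hw L hL, run_eq_sum hw L' hL']
  have hp : L.Perm L' := (List.perm_ext_iff_of_nodup hL.1 hL'.1).2 h
  refine Finset.sum_congr rfl fun B _ => ?_
  rw [(hp.map _).prod_eq]
  simp only [h]

theorem run_congr_base [Fintype C] (hw : ∀ c, DependsOn (w c) (dep c)) {L : List C}
    (hL : Topological dep L) (f : (C → Prop) → ℝ) {A A' : C → Prop} (h : ∀ c, c ∉ L → A c = A' c) :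
    run w L f A = run w L f A' := by
  rw [run_eq_sum hw L hL, run_eq_sum hw L hL]
  refine Finset.sum_congr rfl fun B _ => ?_
  have : (∀ c, c ∉ L → B c = A c) ↔ (∀ c, c ∉ L → B c = A' c) :=
    forall₂_congr fun c hc => by rw [h c hc]
  simp only [this]

theorem run_map {C' : Type*} {w' : C' → (C' → Prop) → ℝ} {i : C → C'} (hi : Function.Injective i)
    (hw : ∀ c A, w' (i c) A = w c (A ∘ i)) (L : List C) (f : (C → Prop) → ℝ) :
    run w' (L.map i) (fun A => f (A ∘ i)) = fun A => run w L f (A ∘ i) := by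
  induction L with
  | nil => rfl
  | cons c L ih =>
    funext A
    simp only [List.map_cons, run, ih, step, hw, Function.update_comp_eq_of_injective _ hi]

/-- Averages commute with restriction along an injection of the cells onto a set of cells which is
closed under dependence. -/
theorem run_comap [Fintype C] {C' : Type*} [Fintype C'] {w' : C' → (C' → Prop) → ℝ}
    {dep' : C' → Set C'}
    (hw' : ∀ c, DependsOn (w' c) (dep' c)) {i : C → C'} (hi : Function.Injective i)
    (hww : ∀ c A, w' (i c) A = w c (A ∘ i)) (hdep : ∀ c, dep' (i c) = i '' dep c)
    {L : List C} {L' : List C'} (hL : Topological dep L) (hL' : Topological dep' L')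
    (hLL : ∀ c, i c ∈ L' ↔ c ∈ L) (f : (C → Prop) → ℝ) :
    run w' L' (fun A => f (A ∘ i)) = fun A => run w L f (A ∘ i) := by
  rw [← run_map hi hww]
  have hf : DependsOn (fun A : C' → Prop => f (A ∘ i)) (Set.range i) := fun A B h => by
    have : A ∘ i = B ∘ i := funext fun c => h (i c) ⟨c, rfl⟩
    simp only [this]
  rw [← run_filter hw' (S := Set.range i) L' ?_ hf]
  · refine run_congr_list hw' ⟨hL'.1.filter _, hL'.2.1.filter _, fun c hc =>
      hL'.2.2 c (List.mem_of_mem_filter hc)⟩ ⟨hL.1.map hi, ?_, ?_⟩ ?_ _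
    · rw [List.pairwise_map]
      refine hL.2.1.imp fun {a b} h => ?_
      rw [hdep]
      rintro ⟨x, hx, hxb⟩
      exact h (hi hxb ▸ hx)
    · intro c hc
      obtain ⟨x, hx, rfl⟩ := List.mem_map.1 hc
      rw [hdep]
      rintro ⟨y, hy, hyx⟩
      exact hL.2.2 x hx (hi hyx ▸ hy)
    · intro c
      simp only [List.mem_filter, List.mem_map, decide_eq_true_eq]
      constructor
      · rintro ⟨h, x, rfl⟩
        exact ⟨x, (hLL x).1 h, rfl⟩
      · rintro ⟨x, hx, rfl⟩
        exact ⟨(hLL x).2 hx, x, rfl⟩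
  · rintro _ - ⟨c, rfl⟩
    rw [hdep]
    exact Set.image_subset_range _ _

theorem exists_topological [Fintype C] {rank : C → ℕ} (h : ∀ c, ∀ c' ∈ dep c, rank c' < rank c)
    (S : Set C) : ∃ L, Topological dep L ∧ ∀ c, c ∈ L ↔ c ∈ S := by
  let L := ((Finset.univ.filter (· ∈ S)).toList).insertionSort (fun a b => rank a ≤ rank b)
  have hp := List.perm_insertionSort (fun a b => rank a ≤ rank b)
    (Finset.univ.filter (· ∈ S)).toList
  have : Std.Total (fun a b : C => rank a ≤ rank b) := ⟨fun a b => le_total _ _⟩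
  have : IsTrans C (fun a b : C => rank a ≤ rank b) := ⟨fun a b c => le_trans⟩
  refine ⟨L, ⟨hp.nodup_iff.2 (Finset.nodup_toList _), ?_, ?_⟩, fun c => ?_⟩
  · exact (List.pairwise_insertionSort (fun a b => rank a ≤ rank b) _).imp
      fun {a b} hab hb => (h a b hb).not_ge hab
  · exact fun c _ hc => (h c c hc).ne rfl
  · rw [hp.mem_iff]; simp

theorem topological_append {L L' : List C} (hL : Topological dep L) (hL' : Topological dep L')
    (hdisj : ∀ c ∈ L, c ∉ L') (h : ∀ c ∈ L, ∀ c' ∈ L', c' ∉ dep c) :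
    Topological dep (L ++ L') := by
  refine ⟨List.nodup_append.2 ⟨hL.1, hL'.1, ?_⟩, List.pairwise_append.2 ⟨hL.2.1, hL'.2.1, h⟩, ?_⟩
  · rintro a ha b hb rfl; exact hdisj a ha hb
  · intro c hc
    rcases List.mem_append.1 hc with hc | hc
    · exact hL.2.2 c hc
    · exact hL'.2.2 c hc

end Chain

/-! ### Atomic types of tuples. -/

section Types

variable {ι : Type u} {ar : ι → ℕ}

/-- Atomic types of `l`-tuples: the equalities and the atoms which hold between the entries. -/
abbrev AType (ar : ι → ℕ) (l : ℕ) : Type u := Setoid (Fin l) × Struct ar (Fin l)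

/-- The atomic type of a tuple in a structure. -/
def tp {D : Type} (A : Struct ar D) {l : ℕ} (a : Fin l → D) : AType ar l :=
  (Setoid.ker a, fun R v => A R (a ∘ v))

/-- The pullback of an atomic type along a map of the variables. -/
def AType.comap {l k : ℕ} (x : Fin l → Fin k) (t : AType ar k) : AType ar l :=
  (t.1.comap x, fun R v => t.2 R (x ∘ v))

theorem tp_comp {D : Type} (A : Struct ar D) {l k : ℕ} (a : Fin k → D) (x : Fin l → Fin k) :
    tp A (a ∘ x) = (tp A a).comap x := rfl

theorem tp_eq_iff {D D' : Type} {A : Struct ar D} {A' : Struct ar D'} {l : ℕ} {a : Fin l → D}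
    {a' : Fin l → D'} : tp A a = tp A' a' ↔
      (∀ i j, a i = a j ↔ a' i = a' j) ∧ ∀ R v, A R (a ∘ v) ↔ A' R (a' ∘ v) := by
  simp only [tp, Prod.mk.injEq, Setoid.ext_iff, Setoid.ker_def, funext_iff, eq_iff_iff]

theorem ker_iff_tp {D : Type} (A : Struct ar D) {l : ℕ} (a : Fin l → D) (i j : Fin l) :
    (tp A a).1 i j ↔ a i = a j := Iff.rfl

theorem tp_injective_comp {D D' : Type} {i : D → D'} (hi : Function.Injective i)
    (A : Struct ar D') {l : ℕ} (a : Fin l → D) :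
    tp A (i ∘ a) = tp (fun R v => A R (i ∘ v)) a :=
  tp_eq_iff.2 ⟨fun _ _ => hi.eq_iff, fun _ _ => Iff.rfl⟩

instance [Finite ι] (l : ℕ) : Finite (AType ar l) := by
  have : Finite (Setoid (Fin l)) :=
    Finite.of_injective (fun s : Setoid (Fin l) => fun i j => s i j) fun s s' h =>
      Setoid.ext fun i j => iff_of_eq (congrFun (congrFun h i) j)
  infer_instance

/-- Only aggregation lets a formula look beyond the entries of its tuple. Allowing two domains is
what later frees the laws of types from the size of the domain. -/
theorem Formula.value_eq_of_tp_eq (e : unitInterval) {D D' : Type} [Fintype D] [Fintype D']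
    {A : Struct ar D} {A' : Struct ar D'} {l : ℕ} {φ : Formula ar l} (hφ : φ.AggFree)
    {a : Fin l → D} {a' : Fin l → D'} (h : tp A a = tp A' a') :
    φ.value e A a = φ.value e A' a' := by
  obtain ⟨h1, h2⟩ := tp_eq_iff.1 h
  clear h
  induction φ with
  | const c => simp only [value]
  | eq i j => classical simp only [value]; exact if_congr (h1 i j) rfl rfl
  | rel R v => classical simp only [value]; exact if_congr (h2 R v) rfl rfl
  | neg φ ih => simp only [value, ih hφ h1 h2]
  | and φ ψ ih1 ih2 => simp only [value, ih1 hφ.1 h1 h2, ih2 hφ.2 h1 h2]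
  | or φ ψ ih1 ih2 => simp only [value, ih1 hφ.1 h1 h2, ih2 hφ.2 h1 h2]
  | imp φ ψ ih1 ih2 => simp only [value, ih1 hφ.1 h1 h2, ih2 hφ.2 h1 h2]
  | mean φ ψ χ ih1 ih2 ih3 =>
    simp only [value, ih1 hφ.1 h1 h2, ih2 hφ.2.1 h1 h2, ih3 hφ.2.2 h1 h2]
  | agg hk F x p φ ih => exact hφ.elim

end Types

/-! ### Atomic facts as cells, and the network distribution as sequential sampling. -/

section Cells

variable {ι : Type u} {ar : ι → ℕ}

/-- The atomic facts about a domain. -/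
abbrev Cell (ar : ι → ℕ) (D : Type) : Type u := Σ R : ι, (Fin (ar R) → D)

/-- The structure given by the atomic facts which hold in it. -/
def toStruct {D : Type} (A : Cell ar D → Prop) : Struct ar D := fun R a => A ⟨R, a⟩

/-- The facts about the images under a map of domains. -/
def mapCell {D D' : Type} (i : D → D') (c : Cell ar D) : Cell ar D' := ⟨c.1, i ∘ c.2⟩

theorem mapCell_injective {D D' : Type} {i : D → D'} (hi : Function.Injective i) :
    Function.Injective (mapCell (ar := ar) i) := by
  rintro ⟨R, a⟩ ⟨R', a'⟩ h
  simp only [mapCell, Sigma.mk.injEq] at h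
  obtain ⟨rfl, h⟩ := h
  rw [hi.comp_left (eq_of_heq h)]

theorem tp_toStruct_comp {D D' : Type} {i : D → D'} (hi : Function.Injective i)
    (A : Cell ar D' → Prop) {l : ℕ} (a : Fin l → D) :
    tp (toStruct A) (i ∘ a) = tp (toStruct (A ∘ mapCell i)) a :=
  tp_injective_comp hi _ _

theorem dependsOn_tp {D : Type} {l : ℕ} (a : Fin l → D) {β : Type*} (f : AType ar l → β) :
    DependsOn (fun A : Cell ar D → Prop => f (tp (toStruct A) a))
      {c | Set.range c.2 ⊆ Set.range a} := by
  intro A B h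
  have : tp (toStruct A) a = tp (toStruct B) a := tp_eq_iff.2 ⟨fun _ _ => Iff.rfl, fun R v =>
    iff_of_eq (h ⟨R, a ∘ v⟩ (Set.range_comp_subset_range v a))⟩
  simp only [this]

theorem range_snoc {D : Type} {l : ℕ} (a : Fin l → D) (b : D) :
    Set.range (Fin.snoc (α := fun _ => D) a b) = insert b (Set.range a) := by
  ext x
  simp only [Set.mem_range, Set.mem_insert_iff]
  constructor
  · rintro ⟨j, rfl⟩
    refine Fin.lastCases ?_ (fun j => ?_) j <;> simp
  · rintro (rfl | ⟨j, rfl⟩)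
    exacts [⟨Fin.last l, by simp⟩, ⟨j.castSucc, by simp⟩]

namespace Network

variable (G : Network ar) (e : unitInterval)

/-- The probability of a fact given the other ones. -/
noncomputable def cellProb {D : Type} [Fintype D] (c : Cell ar D) (A : Cell ar D → Prop) : ℝ :=
  G.condProb e (toStruct A) c.1 c.2

/-- The facts on which the probability of a given fact depends. -/
def parents {D : Type} (c : Cell ar D) : Set (Cell ar D) :=
  {c' | G.edge c'.1 c.1 ∧ Set.range c'.2 ⊆ Set.range c.2}

theorem condProb_mem {D : Type} [Fintype D] (A : Struct ar D)
    (R : ι) (a : Fin (ar R) → D) : G.condProb e A R a ∈ Set.Icc (0 : ℝ) 1 :=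
  Subtype.prop (p := fun x : ℝ => x ∈ Set.Icc 0 1) _

theorem cellProb_nonneg {D : Type} [Fintype D] (c : Cell ar D) (A : Cell ar D → Prop) :
    0 ≤ G.cellProb e c A := (G.condProb_mem e _ _ _).1

theorem cellProb_le_one {D : Type} [Fintype D] (c : Cell ar D) (A : Cell ar D → Prop) :
    G.cellProb e c A ≤ 1 := (G.condProb_mem e _ _ _).2

/-- Parents have no entries beyond those of the fact itself, so the image of a domain is closed
under dependence. -/
theorem parents_mapCell {D D' : Type} (i : D → D') (c : Cell ar D) :
    G.parents (mapCell i c) = mapCell i '' G.parents c := by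
  ext ⟨R, v⟩
  simp only [parents, mapCell, Set.mem_ofPred_eq, Set.mem_image]
  constructor
  · rintro ⟨h1, h2⟩
    have : ∀ j, ∃ k, i (c.2 k) = v j := fun j => h2 ⟨j, rfl⟩
    choose k hk using this
    exact ⟨⟨R, fun j => c.2 (k j)⟩, ⟨h1, Set.range_comp_subset_range k c.2⟩, by
      simp only [Sigma.mk.injEq, heq_eq_eq, true_and]; exact funext hk⟩
  · rintro ⟨⟨R', v'⟩, ⟨h1, h2⟩, h⟩
    simp only [Sigma.mk.injEq] at h
    obtain ⟨rfl, h⟩ := h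
    obtain rfl := eq_of_heq h
    refine ⟨h1, ?_⟩
    rw [Set.range_comp, Set.range_comp]
    exact Set.image_mono h2

variable {G} in
theorem dependsOn_cellProb (hG : ∀ R, (G.formula R).AggFree) {D : Type} [Fintype D]
    (c : Cell ar D) : DependsOn (G.cellProb e c) (G.parents c) := by
  intro A B h
  refine congrArg Subtype.val (Formula.value_eq_of_tp_eq e (hG c.1) (tp_eq_iff.2
    ⟨fun _ _ => Iff.rfl, fun R v => iff_of_eq (h ⟨R.1, c.2 ∘ v⟩ ⟨R.2, ?_⟩)⟩))
  exact Set.range_comp_subset_range v c.2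

variable {G} in
theorem cellProb_mapCell (hG : ∀ R, (G.formula R).AggFree) {D D' : Type} [Fintype D]
    [Fintype D'] {i : D → D'} (hi : Function.Injective i) (c : Cell ar D)
    (A : Cell ar D' → Prop) :
    G.cellProb e (mapCell i c) A = G.cellProb e c (A ∘ mapCell i) :=
  congrArg Subtype.val (Formula.value_eq_of_tp_eq e (hG c.1) (tp_eq_iff.2
    ⟨fun _ _ => hi.eq_iff, fun _ _ => Iff.rfl⟩))

/-- The number of ancestors of a relation symbol. -/
noncomputable def rank (R : ι) : ℕ := {S | Relation.TransGen G.edge S R}.ncard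

theorem rank_lt [Finite ι] {S R : ι} (h : G.edge S R) : G.rank S < G.rank R := by
  refine Set.ncard_lt_ncard (Set.ssubset_iff_of_subset (fun T hT => hT.tail h) |>.2
    ⟨S, Relation.TransGen.single h, G.acyclic S⟩) (Set.toFinite _)

theorem exists_cellList [Fintype ι] {D : Type} [Fintype D] (S : Set (Cell ar D)) :
    ∃ L, Topological G.parents L ∧ ∀ c, c ∈ L ↔ c ∈ S :=
  exists_topological (rank := fun c => G.rank c.1) (fun _ _ h => G.rank_lt h.1) S

variable [Fintype ι]

/-- The facts in the set `S`, listed in an order in which they may be sampled. -/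
noncomputable def cellList {D : Type} [Fintype D] (S : Set (Cell ar D)) : List (Cell ar D) :=
  (G.exists_cellList S).choose

theorem topological_cellList {D : Type} [Fintype D] (S : Set (Cell ar D)) :
    Topological G.parents (G.cellList S) := (G.exists_cellList S).choose_spec.1

theorem mem_cellList {D : Type} [Fintype D] {S : Set (Cell ar D)} {c : Cell ar D} :
    c ∈ G.cellList S ↔ c ∈ S := (G.exists_cellList S).choose_spec.2 c

/-- The mean of `f` when the facts in `S` are resampled. -/
noncomputable def avg {D : Type} [Fintype D] (S : Set (Cell ar D))
    (f : (Cell ar D → Prop) → ℝ) : (Cell ar D → Prop) → ℝ :=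
  run (G.cellProb e) (G.cellList S) f

variable {G} {e}

theorem avg_mono {D : Type} [Fintype D] (S : Set (Cell ar D)) {f g : (Cell ar D → Prop) → ℝ}
    (h : ∀ A, f A ≤ g A) (A : Cell ar D → Prop) : G.avg e S f A ≤ G.avg e S g A :=
  run_mono (G.cellProb_nonneg e) (G.cellProb_le_one e) _ h A

theorem avg_const {D : Type} [Fintype D] (S : Set (Cell ar D)) (r : ℝ) (A : Cell ar D → Prop) :
    G.avg e S (fun _ => r) A = r := by rw [avg, run_const]

theorem avg_comap (hG : ∀ R, (G.formula R).AggFree)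
    {D D' : Type} [Fintype D] [Fintype D'] {i : D → D'}
    (hi : Function.Injective i) {S : Set (Cell ar D)} {S' : Set (Cell ar D')}
    (hS : ∀ c, mapCell i c ∈ S' ↔ c ∈ S) (f : (Cell ar D → Prop) → ℝ) (A : Cell ar D' → Prop) :
    G.avg e S' (fun A => f (A ∘ mapCell i)) A = G.avg e S f (A ∘ mapCell i) := by
  classical
  exact congrFun (run_comap (dependsOn_cellProb e hG) (mapCell_injective hi)
    (cellProb_mapCell e hG hi) (G.parents_mapCell i) (G.topological_cellList S)
    (G.topological_cellList S') (fun c => by rw [mem_cellList, mem_cellList, hS]) f) A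

theorem avg_congr_base (hG : ∀ R, (G.formula R).AggFree)
    {D : Type} [Fintype D] {S : Set (Cell ar D)}
    (f : (Cell ar D → Prop) → ℝ) {A A' : Cell ar D → Prop} (h : ∀ c, c ∉ S → A c = A' c) :
    G.avg e S f A = G.avg e S f A' := by
  classical
  exact run_congr_base (dependsOn_cellProb e hG) (G.topological_cellList S) f fun c hc =>
    h c (by rwa [mem_cellList] at hc)

/-- Resampling everything amounts to first sampling the facts about `T` and then the other
ones. -/
theorem avg_univ_eq (hG : ∀ R, (G.formula R).AggFree)
    {D : Type} [Fintype D] (T : Set D) (f : (Cell ar D → Prop) → ℝ) :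
    G.avg e Set.univ f =
      G.avg e {c | Set.range c.2 ⊆ T} (G.avg e {c | ¬ Set.range c.2 ⊆ T} f) := by
  classical
  rw [avg, avg, avg, ← run_append]
  refine run_congr_list (dependsOn_cellProb e hG) (G.topological_cellList _)
    (topological_append (G.topological_cellList _) (G.topological_cellList _) ?_ ?_) ?_ f
  · intro c hc hc'
    exact G.mem_cellList.1 hc' (G.mem_cellList.1 hc)
  -- A fact about `T` has only parents about `T`, so sampling these facts first respects the
  -- dependencies.
  · intro c hc c' hc' h
    exact G.mem_cellList.1 hc' (h.2.trans (G.mem_cellList.1 hc))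
  · intro c
    simp only [mem_cellList, List.mem_append, Set.mem_univ, Set.mem_ofPred_eq, true_iff]
    exact em _

/-- This identifies expectation under the network with sampling. The start `A` is arbitrary because
every fact is resampled. -/
theorem sum_weight_mul (hG : ∀ R, (G.formula R).AggFree)
    {D : Type} [Fintype D] [Fintype (Struct ar D)] (f : Struct ar D → ℝ)
    (A : Cell ar D → Prop) :
    ∑ B : Struct ar D, f B * G.weight e B = G.avg e Set.univ (fun B => f (toStruct B)) A := by
  classical
  rw [avg, run_eq_sum (dependsOn_cellProb e hG) _ (G.topological_cellList _)]
  rw [← (Equiv.piCurry fun (R : ι) (_ : Fin (ar R) → D) => Prop).sum_comp]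
  refine Finset.sum_congr (by ext; simp) fun B _ => ?_
  rw [if_pos fun c hc => (hc (G.mem_cellList.2 trivial)).elim]
  congr 1
  rw [← List.prod_toFinset (fun c => cellWeight (G.cellProb e) c B) (G.topological_cellList _).1]
  have : (G.cellList (Set.univ : Set (Cell ar D))).toFinset = Finset.univ := by
    ext c; simp [mem_cellList]
  rw [this, Fintype.prod_sigma]
  unfold weight
  refine Finset.prod_congr rfl fun R _ => Finset.prod_congr (by congr) fun a _ => ?_
  unfold cellWeight
  congr

open Classical in
theorem prob_eq_avg (hG : ∀ R, (G.formula R).AggFree)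
    (n : ℕ) (X : Set (Struct ar (Fin n))) (A : Cell ar (Fin n) → Prop) :
    G.prob e n X = G.avg e Set.univ (fun B => if toStruct B ∈ X then 1 else 0) A := by
  rw [← sum_weight_mul hG (f := fun B => if B ∈ X then 1 else 0)]
  unfold prob
  simp only [ite_mul, one_mul, zero_mul]

end Network

end Cells

/-! ### Events of high probability, and the law of one-point extensions. -/

section Probability

variable {ι : Type u} [Fintype ι] {ar : ι → ℕ} {G : Network ar} {e : unitInterval}

namespace Network

theorem weight_nonneg {D : Type} [Fintype D] (A : Struct ar D) : 0 ≤ G.weight e A := by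
  unfold weight
  refine Finset.prod_nonneg fun R _ => Finset.prod_nonneg fun a _ => ?_
  split_ifs
  · exact (G.condProb_mem e A R a).1
  · exact sub_nonneg.2 (G.condProb_mem e A R a).2

theorem prob_nonneg (n : ℕ) (X : Set (Struct ar (Fin n))) : 0 ≤ G.prob e n X := by
  classical
  refine Finset.sum_nonneg fun A _ => ?_
  split_ifs
  exacts [weight_nonneg A, le_rfl]

theorem prob_mono {n : ℕ} {X Y : Set (Struct ar (Fin n))} (h : X ⊆ Y) :
    G.prob e n X ≤ G.prob e n Y := by
  classical
  refine Finset.sum_le_sum fun A _ => ?_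
  by_cases hX : A ∈ X
  · rw [if_pos hX, if_pos (h hX)]
  · rw [if_neg hX]
    split_ifs
    exacts [weight_nonneg A, le_rfl]

theorem prob_union_le {n : ℕ} (X Y : Set (Struct ar (Fin n))) :
    G.prob e n (X ∪ Y) ≤ G.prob e n X + G.prob e n Y := by
  classical
  unfold prob
  rw [← Finset.sum_add_distrib]
  refine Finset.sum_le_sum fun A _ => ?_
  have := weight_nonneg (G := G) (e := e) A
  by_cases hX : A ∈ X <;> by_cases hY : A ∈ Y <;> simp [hX, hY, this]

theorem prob_empty (n : ℕ) : G.prob e n ∅ = 0 := by simp [prob]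

theorem prob_biUnion_le {n : ℕ} {β : Type*} (s : Finset β) (X : β → Set (Struct ar (Fin n))) :
    G.prob e n (⋃ b ∈ s, X b) ≤ ∑ b ∈ s, G.prob e n (X b) := by
  classical
  induction s using Finset.induction_on with
  | empty => simp [prob_empty]
  | insert b s hb ih =>
    rw [Finset.set_biUnion_insert, Finset.sum_insert hb]
    exact (prob_union_le _ _).trans (by gcongr)

theorem prob_iUnion_le {n : ℕ} {β : Type*} [Fintype β] (X : β → Set (Struct ar (Fin n))) :
    G.prob e n (⋃ b, X b) ≤ ∑ b, G.prob e n (X b) := by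
  simpa using prob_biUnion_le (G := G) (e := e) Finset.univ X

theorem prob_univ (hG : ∀ R, (G.formula R).AggFree) (n : ℕ) : G.prob e n Set.univ = 1 := by
  classical
  rw [prob_eq_avg hG n _ (fun _ => True)]
  simp [avg_const]

/-- The events `X n` hold with probability tending to one. -/
def Whp (G : Network ar) (e : unitInterval) (X : ∀ n, Set (Struct ar (Fin n))) : Prop :=
  Tendsto (fun n => G.prob e n (X n)ᶜ) atTop (𝓝 0)

theorem Whp.mono {X Y : ∀ n, Set (Struct ar (Fin n))} (h : G.Whp e X)
    (hXY : ∀ᶠ n in atTop, X n ⊆ Y n) : G.Whp e Y :=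
  tendsto_of_tendsto_of_tendsto_of_le_of_le' tendsto_const_nhds h
    (Eventually.of_forall fun _ => prob_nonneg _ _)
    (hXY.mono fun _ h => prob_mono (Set.compl_subset_compl.2 h))

theorem whp_of_prob_compl_eq_zero {X : ∀ n, Set (Struct ar (Fin n))}
    (h : ∀ n, G.prob e n (X n)ᶜ = 0) : G.Whp e X := by
  simp only [Whp, h, tendsto_const_nhds]

theorem whp_univ : G.Whp e fun _ => Set.univ :=
  whp_of_prob_compl_eq_zero fun n => by simp [prob_empty]

theorem Whp.iInter {β : Type*} [Finite β] {X : β → ∀ n, Set (Struct ar (Fin n))}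
    (h : ∀ b, G.Whp e (X b)) : G.Whp e (fun n => ⋂ b, X b n) := by
  have := Fintype.ofFinite β
  have hs : Tendsto (fun n => ∑ b, G.prob e n (X b n)ᶜ) atTop (𝓝 0) := by
    simpa using tendsto_finsetSum Finset.univ fun b _ => h b
  refine tendsto_of_tendsto_of_tendsto_of_le_of_le tendsto_const_nhds hs
    (fun _ => prob_nonneg _ _) fun n => ?_
  simp only [Set.compl_iInter]
  exact prob_iUnion_le _

theorem Whp.inter {X Y : ∀ n, Set (Struct ar (Fin n))} (hX : G.Whp e X) (hY : G.Whp e Y) :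
    G.Whp e (fun n => X n ∩ Y n) := by
  have := Whp.iInter (G := G) (e := e) (β := Bool) (X := fun b n => cond b (X n) (Y n))
    (by rintro (_ | _); exacts [hY, hX])
  refine this.mono (Eventually.of_forall fun n A hA => ?_)
  rw [Set.mem_iInter] at hA
  exact ⟨hA true, hA false⟩

/-- Markov's inequality for exponential moments. -/
theorem prob_le_of_exp (hG : ∀ R, (G.formula R).AggFree) {n : ℕ} (X : Set (Struct ar (Fin n)))
    (f : Struct ar (Fin n) → ℝ) (r M : ℝ) (hX : ∀ A ∈ X, r ≤ f A) (A : Cell ar (Fin n) → Prop)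
    (hM : G.avg e Set.univ (fun B => Real.exp (f (toStruct B))) A ≤ M) :
    G.prob e n X ≤ Real.exp (-r) * M := by
  classical
  rw [prob_eq_avg hG n X A]
  refine le_trans ?_ (mul_le_mul_of_nonneg_left hM (Real.exp_pos _).le)
  have : Real.exp (-r) * G.avg e Set.univ (fun B => Real.exp (f (toStruct B))) A =
      G.avg e Set.univ (fun B => Real.exp (-r) * Real.exp (f (toStruct B))) A := by
    rw [avg, avg, run_const_mul]
  rw [this]
  refine avg_mono _ (fun B => ?_) A
  split_ifs with h
  · rw [← Real.exp_add]
    exact Real.one_le_exp (by linarith [hX _ h])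
  · positivity

/-! ### One-point extensions -/

/-- The structure on the distinct entries of a tuple of type `t`, with an additional point of
which no fact holds. -/
def baseStruct {l : ℕ} (t : AType ar l) (c : Cell ar (Option (Quotient t.1))) : Prop :=
  ∃ v : Fin (ar c.1) → Fin l, (∀ j, c.2 j = some (Quotient.mk _ (v j))) ∧ t.2 c.1 v

/-- The mean of `g` over the types of the extensions of a tuple of type `t` by a new point. -/
noncomputable def extMean (G : Network ar) (e : unitInterval) {l : ℕ}
    (g : AType ar (l + 1) → ℝ) (t : AType ar l) : ℝ :=
  haveI := Fintype.ofFinite (Quotient t.1)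
  G.avg e {c | none ∈ Set.range c.2}
    (fun A => g (tp (toStruct A) (Fin.snoc (α := fun _ => Option (Quotient t.1))
      (fun j => some (Quotient.mk _ j)) none))) (baseStruct t)

/-- The entries of `a` and the point `b` form a copy of `Option (Quotient (Setoid.ker a))`, and the
facts about this copy do not depend on any others. Hence the conditional mean is a function of the
type of `a` alone, the same one in all domains. -/
theorem avg_tp_snoc (hG : ∀ R, (G.formula R).AggFree) {D : Type} [Fintype D] {l : ℕ}
    (g : AType ar (l + 1) → ℝ) (a : Fin l → D) {b : D} (hb : b ∉ Set.range a)
    (A : Cell ar D → Prop) :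
    G.avg e {c | ¬ Set.range c.2 ⊆ Set.range a}
      (fun A => g (tp (toStruct A) (Fin.snoc (α := fun _ => D) a b))) A =
      G.extMean e g (tp (toStruct A) a) := by
  let _ := Fintype.ofFinite (Quotient (Setoid.ker a))
  let i : Option (Quotient (Setoid.ker a)) → D :=
    fun o => o.elim b (Quotient.lift a fun _ _ h => h)
  have hisome : ∀ j, i (some (Quotient.mk _ j)) = a j := fun _ => rfl
  have hi : Function.Injective i := by
    rintro (_ | x) (_ | y) h
    · rfl
    · induction y using Quotient.inductionOn with | h y => exact (hb ⟨y, h.symm⟩).elim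
    · induction x using Quotient.inductionOn with | h x => exact (hb ⟨x, h⟩).elim
    · induction x using Quotient.inductionOn with | h x =>
      induction y using Quotient.inductionOn with | h y =>
      exact congrArg some (Quotient.sound h)
  have hsnoc : Fin.snoc (α := fun _ => D) a b = i ∘ Fin.snoc
      (α := fun _ => Option (Quotient (Setoid.ker a))) (fun j => some (Quotient.mk _ j)) none := by
    funext j
    refine Fin.lastCases ?_ (fun j => ?_) j <;> simp [i]
  simp only [hsnoc, tp_toStruct_comp hi]
  rw [avg_comap hG hi
    (S := {c : Cell ar (Option (Quotient (Setoid.ker a))) | none ∈ Set.range c.2}) ?_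
    (fun A => g (tp (toStruct A) _))]
  -- The starting structures need to agree only on facts that avoid `none`, and those are given by
  -- the type of `a`.
  · refine avg_congr_base (D := Option (Quotient (Setoid.ker a))) hG _ fun c hc => ?_
    have : ∀ j, ∃ k, c.2 j = some (Quotient.mk _ k) := by
      intro j
      rcases h : c.2 j with _ | x
      · exact (hc ⟨j, h⟩).elim
      · induction x using Quotient.inductionOn with | h x => exact ⟨x, rfl⟩
    choose v hv using this
    have hA : ∀ v : Fin (ar c.1) → Fin l, (∀ j, c.2 j = some (Quotient.mk _ (v j))) →
        ((A ∘ mapCell i) c ↔ toStruct A c.1 (a ∘ v)) := by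
      intro v hv
      have : i ∘ c.2 = a ∘ v := by funext j; simp [hv, hisome]
      simp only [Function.comp_apply, mapCell, toStruct, this]
    refine propext ⟨fun h => ⟨v, hv, (hA v hv).1 h⟩, ?_⟩
    rintro ⟨v', hv', h⟩
    exact (hA v' hv').2 h
  · intro c
    simp only [mapCell, Set.mem_ofPred_eq]
    constructor
    · intro h
      by_contra hn
      refine h ?_
      rintro _ ⟨j, rfl⟩
      rcases h : c.2 j with _ | x
      · exact (hn ⟨j, h⟩).elim
      · induction x using Quotient.inductionOn with | h x => exact ⟨x, by simp [h, hisome]⟩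
    · rintro ⟨j, hj⟩ h
      have := h ⟨j, rfl⟩
      rw [Function.comp_apply, hj] at this
      exact hb this

theorem extMean_nonneg {l : ℕ} {g : AType ar (l + 1) → ℝ} (hg : ∀ t, 0 ≤ g t) (t : AType ar l) :
    0 ≤ G.extMean e g t := by
  let _ := Fintype.ofFinite (Quotient t.1)
  unfold extMean
  exact (avg_const (G := G) (e := e) _ 0 (baseStruct t)).ge.trans
    (avg_mono (D := Option (Quotient t.1)) _ (fun _ => hg _) _)

theorem extMean_le_one {l : ℕ} {g : AType ar (l + 1) → ℝ} (hg : ∀ t, g t ≤ 1) (t : AType ar l) :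
    G.extMean e g t ≤ 1 := by
  let _ := Fintype.ofFinite (Quotient t.1)
  unfold extMean
  exact (avg_mono (D := Option (Quotient t.1)) _ (fun _ => hg _) _).trans
    (avg_const (G := G) (e := e) _ 1 (baseStruct t)).le

/-- From `exp x ≤ 1 + x + x ^ 2` for `|x| ≤ 1`: the linear term has conditional mean zero, and `1 +
r ^ 2 ≤ exp (r ^ 2)`. -/
theorem avg_exp_sub_le (hG : ∀ R, (G.formula R).AggFree) {D : Type} [Fintype D] {l : ℕ}
    {g : AType ar (l + 1) → ℝ} (hg0 : ∀ t, 0 ≤ g t) (hg1 : ∀ t, g t ≤ 1) {r : ℝ} (hr : |r| ≤ 1)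
    (a : Fin l → D) {b : D} (hb : b ∉ Set.range a) (A : Cell ar D → Prop) :
    G.avg e {c | ¬ Set.range c.2 ⊆ Set.range a}
      (fun A => Real.exp (r * (g (tp (toStruct A) (Fin.snoc (α := fun _ => D) a b)) -
        G.extMean e g (tp (toStruct A) a)))) A ≤ Real.exp (r ^ 2) := by
  have h1 : ∀ A : Cell ar D → Prop,
      Real.exp (r * (g (tp (toStruct A) (Fin.snoc (α := fun _ => D) a b)) -
        G.extMean e g (tp (toStruct A) a))) ≤
      (1 + r ^ 2 + -r * G.extMean e g (tp (toStruct A) a)) +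
        r * g (tp (toStruct A) (Fin.snoc (α := fun _ => D) a b)) := by
    intro A
    set x := g (tp (toStruct A) (Fin.snoc (α := fun _ => D) a b))
    set y := G.extMean e g (tp (toStruct A) a)
    have hxy : |x - y| ≤ 1 := abs_sub_le_iff.2
      ⟨by linarith [hg1 (tp (toStruct A) (Fin.snoc (α := fun _ => D) a b)),
        extMean_nonneg (G := G) (e := e) hg0 (tp (toStruct A) a)],
       by linarith [hg0 (tp (toStruct A) (Fin.snoc (α := fun _ => D) a b)),
        extMean_le_one (G := G) (e := e) hg1 (tp (toStruct A) a)]⟩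
    have h : |r * (x - y)| ≤ 1 := by
      rw [abs_mul]; exact mul_le_one₀ hr (abs_nonneg _) hxy
    have h2 := (abs_le.1 (Real.abs_exp_sub_one_sub_id_le h)).2
    have h3 : (r * (x - y)) ^ 2 ≤ r ^ 2 := by
      rw [mul_pow]
      have : (x - y) ^ 2 ≤ 1 := by rw [← sq_abs]; exact pow_le_one₀ (abs_nonneg _) hxy
      nlinarith [sq_nonneg r]
    linarith
  refine (avg_mono _ h1 A).trans ?_
  have h2 : DependsOn (fun A : Cell ar D → Prop =>
      1 + r ^ 2 + -r * G.extMean e g (tp (toStruct A) a)) {c | Set.range c.2 ⊆ Set.range a} :=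
    dependsOn_tp a fun t => 1 + r ^ 2 + -r * G.extMean e g t
  have h3 := avg_tp_snoc (e := e) hG g a hb A
  rw [avg] at h3 ⊢
  rw [run_add]
  beta_reduce
  rw [run_const_mul]
  beta_reduce
  rw [h3, run_of_dependsOn (w := G.cellProb e) (G.cellList {c | ¬ Set.range c.2 ⊆ Set.range a}) h2
    fun c hc => G.mem_cellList.1 hc]
  have := Real.add_one_le_exp (r ^ 2)
  linarith

/-- Given the facts about `a`, the terms for different `b` are independent, so the exponential
moment is at most a product of one-point bounds. -/
theorem avg_exp_sum_le (hG : ∀ R, (G.formula R).AggFree) {D : Type} [Fintype D] {l : ℕ}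
    {g : AType ar (l + 1) → ℝ} (hg0 : ∀ t, 0 ≤ g t) (hg1 : ∀ t, g t ≤ 1) {r : ℝ} (hr : |r| ≤ 1)
    (a : Fin l → D) {s : Finset D} (hs : ∀ b ∈ s, b ∉ Set.range a) (A : Cell ar D → Prop) :
    G.avg e Set.univ (fun A => Real.exp (r * ∑ b ∈ s,
      (g (tp (toStruct A) (Fin.snoc (α := fun _ => D) a b)) -
        G.extMean e g (tp (toStruct A) a)))) A ≤ Real.exp (r ^ 2 * Fintype.card D) := by
  rw [avg_univ_eq hG (Set.range a)]
  refine (avg_mono _ (g := fun _ => Real.exp (r ^ 2 * Fintype.card D)) (fun A => ?_) A).trans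
    (avg_const _ _ _).le
  simp only [Finset.mul_sum, Real.exp_sum]
  rw [avg, run_prod (dependsOn_cellProb e hG) _
    (fun b => {c | Set.range c.2 ⊆ Set.range (Fin.snoc (α := fun _ => D) a b)})]
  · calc _ ≤ ∏ b ∈ s, Real.exp (r ^ 2) := by
          refine Finset.prod_le_prod (fun b _ => ?_) fun b hb => ?_
          · rw [← avg_const (G := G) (e := e) {c | ¬ Set.range c.2 ⊆ Set.range a} 0 A]
            exact avg_mono _ (fun _ => (Real.exp_pos _).le) _
          · exact avg_exp_sub_le hG hg0 hg1 hr a (hs b hb) A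
      _ ≤ _ := by
          rw [Finset.prod_const, ← Real.exp_nat_mul, mul_comm]
          refine Real.exp_le_exp.2 (mul_le_mul_of_nonneg_left ?_ (sq_nonneg r))
          exact_mod_cast Finset.card_le_univ _
  · intro c _ b hc c' hc'
    exact hc'.2.trans hc
  -- A resampled fact has an entry outside `a`; being among the entries of `a` and `b`, this entry
  -- must be `b`.
  · intro c hc b b' hb hb'
    obtain ⟨x, hx, hxa⟩ := Set.not_subset.1 (G.mem_cellList.1 hc)
    have h1 := hb hx
    have h2 := hb' hx
    rw [range_snoc] at h1 h2
    rw [← h1.resolve_right hxa, ← h2.resolve_right hxa]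
  · intro b
    have := dependsOn_tp (ar := ar) (Fin.snoc (α := fun _ => D) a b)
      fun t => Real.exp (r * (g t - G.extMean e g (t.comap Fin.castSucc)))
    simp only [← tp_comp] at this
    convert this using 7
    funext j
    simp

end Network
end Probability

/-! ### A uniform law of large numbers for extensions of tuples. -/

section LargeNumbers

variable {ι : Type u} [Fintype ι] {ar : ι → ℕ} {G : Network ar} {e : unitInterval}

/-- The tuples of distinct elements which do not occur in `a`. -/
def IsNew {D : Type} {l q : ℕ} (a : Fin l → D) (b : Fin q → D) : Prop :=
  Function.Injective b ∧ ∀ i j, a i ≠ b j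

namespace Network

open Classical in
theorem prob_deviation_le (hG : ∀ R, (G.formula R).AggFree) {l : ℕ}
    {g : AType ar (l + 1) → ℝ} (hg0 : ∀ t, 0 ≤ g t) (hg1 : ∀ t, g t ≤ 1) {ε : ℝ} (hε : 0 < ε)
    (hε1 : ε ≤ 1) {n : ℕ} (a : Fin l → Fin n) :
    G.prob e n {A | ε * n ≤ |∑ b ∈ Finset.univ.filter (· ∉ Set.range a),
      (g (tp A (Fin.snoc (α := fun _ => Fin n) a b)) - G.extMean e g (tp A a))|} ≤
      2 * Real.exp (-(ε ^ 2 / 4)) ^ n := by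
  set s : Struct ar (Fin n) → ℝ := fun A => ∑ b ∈ Finset.univ.filter (· ∉ Set.range a),
      (g (tp A (Fin.snoc (α := fun _ => Fin n) a b)) - G.extMean e g (tp A a))
  have key : ∀ σ : ℝ, |σ| = 1 → G.prob e n {A | ε * n ≤ σ * s A} ≤
      Real.exp (-(ε ^ 2 / 4)) ^ n := by
    intro σ hσ
    have hσ2 : σ ^ 2 = 1 := by rw [← sq_abs, hσ, one_pow]
    -- The size `ε / 2` minimises the exponent `r ^ 2 * n - r * ε * n`, giving `-(ε ^ 2 / 4) * n`;
    -- `σ` covers both tails.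
    have h := avg_exp_sum_le (e := e) hG hg0 hg1 (r := ε / 2 * σ)
      (by rw [abs_mul, hσ, abs_of_pos (by positivity)]; linarith) a
      (s := Finset.univ.filter (· ∉ Set.range a)) (fun b hb => (Finset.mem_filter.1 hb).2)
      (fun _ => True)
    refine (prob_le_of_exp hG _ (fun A => ε / 2 * σ * s A) (ε / 2 * (ε * n)) _ ?_ _ h).trans
      (le_of_eq ?_)
    · intro A hA
      rw [mul_assoc]
      exact mul_le_mul_of_nonneg_left hA (by positivity)
    · rw [← Real.exp_add, ← Real.exp_nat_mul, Fintype.card_fin, mul_pow, hσ2]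
      congr 1
      ring
  calc G.prob e n {A | ε * n ≤ |s A|}
      ≤ G.prob e n ({A | ε * n ≤ 1 * s A} ∪ {A | ε * n ≤ -1 * s A}) := by
        refine prob_mono fun A hA => ?_
        rcases le_abs.1 (show ε * n ≤ |s A| from hA) with h | h
        · exact Or.inl (by simpa using h)
        · exact Or.inr (by simpa using h)
    _ ≤ _ := (prob_union_le _ _).trans (by
        rw [two_mul]; exact add_le_add (key 1 (by simp)) (key (-1) (by simp)))

/-- The exponential bound beats the `n ^ l` tuples in a union bound. The points `b` among the
entries of `a` contribute at most `l` to the sum. -/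
theorem whp_deviation (hG : ∀ R, (G.formula R).AggFree) {l : ℕ}
    {g : AType ar (l + 1) → ℝ} (hg0 : ∀ t, 0 ≤ g t) (hg1 : ∀ t, g t ≤ 1) {ε : ℝ} (hε : 0 < ε) :
    G.Whp e fun n => {A | ∀ a : Fin l → Fin n,
      |(∑ b, g (tp A (Fin.snoc (α := fun _ => Fin n) a b))) / n - G.extMean e g (tp A a)| ≤ ε} := by
  classical
  -- Half of `ε` is kept for the at most `l` points that occur in `a`; the tail bound requires `δ ≤
  -- 1`.
  set δ := min (ε / 2) 1
  have hδ : 0 < δ := by positivity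
  have h1 : G.Whp e fun n => {A | ∀ a : Fin l → Fin n,
      |∑ b ∈ Finset.univ.filter (· ∉ Set.range a),
        (g (tp A (Fin.snoc (α := fun _ => Fin n) a b)) - G.extMean e g (tp A a))| < δ * n} := by
    have hlim : Tendsto (fun n : ℕ => 2 * ((n : ℝ) ^ l * Real.exp (-(δ ^ 2 / 4)) ^ n)) atTop
        (𝓝 0) := by
      have := tendsto_pow_const_mul_const_pow_of_abs_lt_one l
        (r := Real.exp (-(δ ^ 2 / 4))) (by
          rw [abs_of_pos (Real.exp_pos _), Real.exp_lt_one_iff]; simp; positivity)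
      simpa using this.const_mul 2
    refine tendsto_of_tendsto_of_tendsto_of_le_of_le tendsto_const_nhds hlim
      (fun _ => prob_nonneg _ _) fun n => ?_
    have hsub : {A | ∀ a : Fin l → Fin n, |∑ b ∈ Finset.univ.filter (· ∉ Set.range a),
          (g (tp A (Fin.snoc (α := fun _ => Fin n) a b)) - G.extMean e g (tp A a))| < δ * n}ᶜ ⊆
        ⋃ a : Fin l → Fin n, {A | δ * n ≤ |∑ b ∈ Finset.univ.filter (· ∉ Set.range a),
          (g (tp A (Fin.snoc (α := fun _ => Fin n) a b)) - G.extMean e g (tp A a))|} := by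
      intro A hA
      simp only [Set.mem_compl_iff, Set.mem_ofPred_eq, not_forall, not_lt] at hA
      exact Set.mem_iUnion.2 hA
    refine (prob_mono hsub).trans ((prob_iUnion_le _).trans ?_)
    refine (Finset.sum_le_sum fun a _ =>
      prob_deviation_le hG hg0 hg1 hδ (min_le_right _ _) a).trans (le_of_eq ?_)
    simp only [Finset.sum_const, Finset.card_univ, Fintype.card_fun, Fintype.card_fin, nsmul_eq_mul,
      Nat.cast_pow]
    ring
  refine h1.mono ?_
  filter_upwards [eventually_ge_atTop (⌈l / (ε / 2)⌉₊ + 1)] with n hn A hA a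
  have hn0 : (0 : ℝ) < n := by
    have : 0 < n := by omega
    exact_mod_cast this
  have hln : (l : ℝ) ≤ ε / 2 * n := by
    have : (l : ℝ) / (ε / 2) ≤ n := (Nat.le_ceil _).trans (by exact_mod_cast (by omega))
    rwa [div_le_iff₀ (by positivity), mul_comm] at this
  have hAa := hA a
  set H := G.extMean e g (tp A a)
  have hH0 : 0 ≤ H := extMean_nonneg hg0 _
  have hH1 : H ≤ 1 := extMean_le_one hg1 _
  have hin : |∑ b ∈ Finset.univ.filter (¬ · ∉ Set.range a),
      (g (tp A (Fin.snoc (α := fun _ => Fin n) a b)) - H)| ≤ l := by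
    refine (Finset.abs_sum_le_sum_abs _ _).trans ((Finset.sum_le_sum (g := fun _ => (1 : ℝ))
      fun b _ => ?_).trans ?_)
    · exact abs_sub_le_iff.2 ⟨by linarith [hg1 (tp A (Fin.snoc (α := fun _ => Fin n) a b))],
        by linarith [hg0 (tp A (Fin.snoc (α := fun _ => Fin n) a b))]⟩
    · rw [Finset.sum_const, nsmul_eq_mul, mul_one]
      have : (Finset.univ.filter (¬ · ∉ Set.range a)) = Finset.univ.image a := by
        ext x; simp
      rw [this]
      exact_mod_cast Finset.card_image_le.trans (by simp)
  have hsum := Finset.sum_filter_add_sum_filter_not Finset.univ (· ∉ Set.range a)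
    fun b => g (tp A (Fin.snoc (α := fun _ => Fin n) a b)) - H
  have htot : ∑ b, (g (tp A (Fin.snoc (α := fun _ => Fin n) a b)) - H) =
      ((∑ b, g (tp A (Fin.snoc (α := fun _ => Fin n) a b))) / n - H) * n := by
    rw [Finset.sum_sub_distrib, Finset.sum_const, Finset.card_univ, Fintype.card_fin, nsmul_eq_mul]
    field_simp
  rw [htot] at hsum
  have h2 : |((∑ b, g (tp A (Fin.snoc (α := fun _ => Fin n) a b))) / n - H)| * n ≤ ε * n := by
    rw [← abs_of_pos hn0, ← abs_mul, abs_of_pos hn0, ← hsum]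
    refine (abs_add_le _ _).trans ?_
    have : δ * n ≤ ε / 2 * n := mul_le_mul_of_nonneg_right (min_le_left _ _) hn0.le
    linarith
  exact le_of_mul_le_mul_right h2 hn0

/-- Averaging first over the facts not about `a` replaces `g` by `extMean`, so `g` has mean zero on
the event `extMean = 0`. As `g ≥ 0`, every structure in the event has weight zero. -/
theorem prob_extMean_eq_zero (hG : ∀ R, (G.formula R).AggFree) {l : ℕ}
    {g : AType ar (l + 1) → ℝ} (hg0 : ∀ t, 0 ≤ g t) {n : ℕ} (a : Fin l → Fin n) {b : Fin n}
    (hb : b ∉ Set.range a) :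
    G.prob e n {A | G.extMean e g (tp A a) = 0 ∧
      g (tp A (Fin.snoc (α := fun _ => Fin n) a b)) ≠ 0} = 0 := by
  classical
  let z : AType ar l → ℝ := fun t => if G.extMean e g t = 0 then 1 else 0
  have h1 := sum_weight_mul (e := e) hG
    (fun A => z (tp A a) * g (tp A (Fin.snoc (α := fun _ => Fin n) a b))) (fun _ => True)
  rw [avg_univ_eq hG (Set.range a)] at h1
  have h2 : G.avg e {c | ¬ Set.range c.2 ⊆ Set.range a} (fun B => z (tp (toStruct B) a) *
      g (tp (toStruct B) (Fin.snoc (α := fun _ => Fin n) a b))) = fun _ => 0 := by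
    funext A
    have h3 := avg_tp_snoc (e := e) hG g a hb A
    rw [avg] at h3 ⊢
    rw [run_mul_left (G.cellList {c | ¬ Set.range c.2 ⊆ Set.range a}) (dependsOn_tp a z)
      fun c hc => G.mem_cellList.1 hc]
    beta_reduce
    rw [h3]
    simp only [z]
    split_ifs with h
    · rw [h, mul_zero]
    · rw [zero_mul]
  rw [h2, avg_const] at h1
  rw [Finset.sum_eq_zero_iff_of_nonneg] at h1
  · refine Finset.sum_eq_zero fun A _ => ?_
    split_ifs with h
    · have := h1 A (Finset.mem_univ _)
      simpa [z, h.1, h.2] using this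
    · rfl
  · intro A _
    refine mul_nonneg (mul_nonneg ?_ (hg0 _)) (weight_nonneg A)
    simp only [z]
    split_ifs <;> norm_num

theorem whp_of_extMean_eq_zero (hG : ∀ R, (G.formula R).AggFree) {l : ℕ}
    {g : AType ar (l + 1) → ℝ} (hg0 : ∀ t, 0 ≤ g t) :
    G.Whp e fun n => {A | ∀ (a : Fin l → Fin n) (b : Fin n), b ∉ Set.range a →
      G.extMean e g (tp A a) = 0 → g (tp A (Fin.snoc (α := fun _ => Fin n) a b)) = 0} := by
  classical
  refine whp_of_prob_compl_eq_zero fun n => le_antisymm ?_ (prob_nonneg _ _)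
  have hsub : {A | ∀ (a : Fin l → Fin n) (b : Fin n), b ∉ Set.range a →
      G.extMean e g (tp A a) = 0 → g (tp A (Fin.snoc (α := fun _ => Fin n) a b)) = 0}ᶜ ⊆
      ⋃ x ∈ Finset.univ.filter (fun x : (Fin l → Fin n) × Fin n => x.2 ∉ Set.range x.1),
        {A | G.extMean e g (tp A x.1) = 0 ∧
          g (tp A (Fin.snoc (α := fun _ => Fin n) x.1 x.2)) ≠ 0} := by
    intro A hA
    simp only [Set.mem_compl_iff, Set.mem_ofPred_eq, not_forall] at hA
    obtain ⟨a, b, hb, h1, h2⟩ := hA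
    exact Set.mem_biUnion (x := (a, b)) (by simpa using hb) ⟨h1, h2⟩
  refine (prob_mono hsub).trans ((prob_biUnion_le _ _).trans (le_of_eq ?_))
  exact Finset.sum_eq_zero fun x hx =>
    prob_extMean_eq_zero hG hg0 x.1 (Finset.mem_filter.1 hx).2

/-- The law of large numbers for the types of extensions of tuples. -/
theorem exists_extMean (hG : ∀ R, (G.formula R).AggFree) (l q : ℕ)
    (g : AType ar (l + q) → ℝ) (hg0 : ∀ t, 0 ≤ g t) (hg1 : ∀ t, g t ≤ 1) :
    ∃ h : AType ar l → ℝ, (∀ t, 0 ≤ h t) ∧ (∀ t, h t ≤ 1) ∧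
      (∀ ε > 0, G.Whp e fun n => {A | ∀ a : Fin l → Fin n,
        |(∑ b : Fin q → Fin n, g (tp A (Fin.append a b))) / (n : ℝ) ^ q - h (tp A a)| ≤ ε}) ∧
      G.Whp e fun n => {A | ∀ (a : Fin l → Fin n) (b : Fin q → Fin n), IsNew a b →
        h (tp A a) = 0 → g (tp A (Fin.append a b)) = 0} := by
  induction q with
  | zero =>
    have happ : ∀ {n : ℕ} (a : Fin l → Fin n) (b : Fin 0 → Fin n), Fin.append a b = a :=
      fun a b => by rw [Subsingleton.elim b Fin.elim0, Fin.append_elim0]; rfl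
    refine ⟨g, hg0, hg1, fun ε hε => whp_univ.mono (Eventually.of_forall fun n A _ a => ?_),
      whp_univ.mono (Eventually.of_forall fun n A _ a b _ h => ?_)⟩
    · simpa [happ] using hε.le
    · rw [happ]; exact h
  | succ q ih =>
    have happ : ∀ {n : ℕ} (a : Fin l → Fin n) (b : Fin q → Fin n) (x : Fin n),
        Fin.append a (Fin.snoc (α := fun _ => Fin n) b x) =
          Fin.snoc (α := fun _ => Fin n) (Fin.append a b) x := fun a b x => by
      rw [Fin.append_snoc]
    have hnonneg : ∀ t, 0 ≤ G.extMean e (l := l + q) g t := extMean_nonneg hg0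
    -- The last point is averaged out first, so `h` is an iterated one-point mean.
    obtain ⟨h, h0, h1, h2, h3⟩ := ih (G.extMean e (l := l + q) g) hnonneg (extMean_le_one hg1)
    refine ⟨h, h0, h1, fun ε hε => ?_, ?_⟩
    · have hd := whp_deviation (e := e) (l := l + q) hG hg0 hg1 (half_pos hε)
      refine ((h2 _ (half_pos hε)).inter hd).mono ?_
      filter_upwards [eventually_gt_atTop 0] with n hn A hA a
      have hn0 : (0 : ℝ) < n := by exact_mod_cast hn
      have hA1 := hA.1 a
      have hA2 := hA.2
      have hsum : (∑ b : Fin (q + 1) → Fin n, g (tp A (Fin.append a b))) / (n : ℝ) ^ (q + 1) =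
          (∑ b : Fin q → Fin n, (∑ x, g (tp A (Fin.snoc (α := fun _ => Fin n)
            (Fin.append a b) x))) / n) / (n : ℝ) ^ q := by
        rw [← Finset.sum_div, div_div, pow_succ', ← (Fin.snocEquiv fun _ => Fin n).sum_comp,
          Fintype.sum_prod_type, Finset.sum_comm]
        simp only [Fin.snocEquiv, Equiv.coe_fn_mk, happ]
      have hdiff : |(∑ b : Fin q → Fin n, (∑ x, g (tp A (Fin.snoc (α := fun _ => Fin n)
            (Fin.append a b) x))) / n) / (n : ℝ) ^ q -
          (∑ b : Fin q → Fin n, G.extMean e (l := l + q) g (tp A (Fin.append a b))) /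
            (n : ℝ) ^ q| ≤ ε / 2 := by
        rw [← sub_div, ← Finset.sum_sub_distrib, abs_div,
          abs_of_pos (by positivity : (0 : ℝ) < n ^ q),
          div_le_iff₀ (by positivity)]
        refine (Finset.abs_sum_le_sum_abs _ _).trans ((Finset.sum_le_sum fun b _ =>
          hA2 (Fin.append a b)).trans (le_of_eq ?_))
        simp [mul_comm]
      rw [hsum]
      have := abs_sub_le ((∑ b : Fin q → Fin n, (∑ x, g (tp A (Fin.snoc (α := fun _ => Fin n)
            (Fin.append a b) x))) / n) / (n : ℝ) ^ q)
          ((∑ b : Fin q → Fin n, G.extMean e (l := l + q) g (tp A (Fin.append a b))) /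
            (n : ℝ) ^ q) (h (tp A a))
      linarith
    · have hz := whp_of_extMean_eq_zero (e := e) (l := l + q) hG hg0
      refine (h3.inter hz).mono (Eventually.of_forall fun n A hA a b hb h => ?_)
      obtain ⟨hA1, hA2⟩ := hA
      rw [← Fin.snoc_init_self b, happ]
      -- If `h` vanishes at `a`, then `extMean` vanishes at `a` extended by `Fin.init b`, and hence
      -- `g` at its extension by the last, new, entry.
      refine hA2 _ _ ?_ (hA1 a (Fin.init b) ⟨fun i j hij => ?_, fun i j => hb.2 i _⟩ h)
      · rintro ⟨i, hi⟩
        refine Fin.addCases (fun i hi => ?_) (fun i hi => ?_) i hi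
        · rw [Fin.append_left] at hi
          exact hb.2 i _ hi
        · rw [Fin.append_right] at hi
          exact (Fin.castSucc_lt_last i).ne (hb.1 hi)
      · exact Fin.castSucc_injective _ (hb.1 hij)

end Network
end LargeNumbers

/-! ### Limits of admissible aggregation functions. -/

section Admissible

open Classical in
/-- The entries of `s` are labelled by points `c j` at distance less than `δ`, in proportions which
differ from `α` by less than `δ`. -/
def UnitSeq.Near (s : UnitSeq) {t : ℕ} (c α : Fin t → unitInterval) (δ : ℝ) : Prop :=
  ∃ P : List (unitInterval × Fin t), s.1 = P.map Prod.fst ∧ (∀ x ∈ P, dist x.1 (c x.2) < δ) ∧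
    ∀ j, |(P.countP (fun x => x.2 = j) : ℝ) / P.length - α j| < δ

/-- Once `δ n` is below the radius of a ball around each `c j` inside `I j`, having label `j` means
the same as lying in `I j`. -/
theorem convergenceTesting_of_near {t : ℕ} {c α : Fin t → unitInterval} {r : ℕ → UnitSeq}
    {δ : ℕ → ℝ} (hδ : Tendsto δ atTop (𝓝 0)) (hlen : ∀ n, (r n).1.length < (r (n + 1)).1.length)
    (hr : ∀ n, (r n).Near c α (δ n)) : ConvergenceTesting r c α := by
  classical
  refine ⟨hlen, fun I hopen _ hdisj hc => ?_⟩
  choose P hP hdist hprop using hr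
  have hball : ∀ᶠ n in atTop, ∀ j x, dist x (c j) < δ n → x ∈ I j := by
    rw [eventually_all]
    intro j
    obtain ⟨η, hη, hI⟩ := Metric.isOpen_iff.1 (hopen j) (c j) (hc j)
    filter_upwards [hδ.eventually (gt_mem_nhds hη)] with n hn x hx
    exact hI (hx.trans hn)
  refine ⟨?_, fun j => ?_⟩
  · obtain ⟨N, hN⟩ := eventually_atTop.1 hball
    refine ⟨N, fun n hn x hx => ?_⟩
    rw [hP, List.mem_map] at hx
    obtain ⟨y, hy, rfl⟩ := hx
    exact ⟨y.2, hN n hn _ _ (hdist n y hy)⟩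
  · rw [tendsto_iff_dist_tendsto_zero]
    refine squeeze_zero' (Eventually.of_forall fun _ => dist_nonneg) ?_ hδ
    filter_upwards [hball] with n hn
    have hcount : (r n).1.countP (fun x => x ∈ I j) = (P n).countP (fun x => x.2 = j) := by
      rw [hP, List.countP_map]
      refine List.countP_congr fun x hx => ?_
      have hxI := hn _ _ (hdist n x hx)
      simp only [Function.comp_apply, decide_eq_true_eq]
      constructor
      · intro h
        by_contra hne
        exact Set.disjoint_left.1 (hdisj _ _ hne) hxI h
      · rintro rfl
        exact hxI
    rw [hcount, hP, List.length_map, Real.dist_eq]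
    exact (hprop n j).le

/-- Sequences of tuples which satisfy finer and finer conditions and have increasing lengths. -/
theorem exists_seq_of_forall {k : ℕ} (Q : ℕ → (Fin k → UnitSeq) → Prop)
    (hQ : ∀ n N, ∃ s, (∀ i, N ≤ (s i).1.length) ∧ Q n s) :
    ∃ r : ℕ → Fin k → UnitSeq, (∀ n, Q n (r n)) ∧
      ∀ i n, (r n i).1.length < (r (n + 1) i).1.length := by
  choose s hlen hs using hQ
  -- Each new length exceeds the sum of all previous ones, hence grows in every coordinate at once.
  let r : ℕ → Fin k → UnitSeq := fun n =>
    Nat.rec (s 0 0) (fun n prev => s (n + 1) (1 + ∑ i, (prev i).1.length)) n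
  have hsucc : ∀ n, r (n + 1) = s (n + 1) (1 + ∑ i, (r n i).1.length) := fun _ => rfl
  refine ⟨r, fun n => ?_, fun i n => ?_⟩
  · cases n with
    | zero => exact hs 0 0
    | succ n => rw [hsucc]; exact hs _ _
  · have h1 := hlen (n + 1) (1 + ∑ i, (r n i).1.length) i
    rw [← hsucc] at h1
    have h2 := Finset.single_le_sum (f := fun i => (r n i).1.length) (fun _ _ => Nat.zero_le _)
      (Finset.mem_univ i)
    omega

/-- Compactness provides a limit `L` along one convergence testing sequence. If the claim failed, a
second such sequence would keep its values at distance `ε` from `L`, against admissibility. -/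
theorem AggFun.Admissible.exists_limit {k : ℕ} {F : AggFun k} (hF : F.Admissible) (t : Fin k → ℕ)
    (c α : (i : Fin k) → Fin (t i) → unitInterval) (ht : ∀ i, 0 < t i)
    (hc : ∀ i, Function.Injective (c i)) (hα : ∀ i j, 0 < α i j) :
    ∃ L : unitInterval, ∀ ε > 0, ∃ δ > 0, ∃ N : ℕ, ∀ s : Fin k → UnitSeq,
      (∀ i, N ≤ (s i).1.length) → (∀ i, (s i).Near (c i) (α i) δ) → dist (F.toFun s) L < ε := by
  have hδ : Tendsto (fun n : ℕ => 1 / ((n : ℝ) + 1)) atTop (𝓝 0) :=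
    tendsto_one_div_add_atTop_nhds_zero_nat
  by_cases hex : ∀ n N : ℕ, ∃ s : Fin k → UnitSeq, (∀ i, N ≤ (s i).1.length) ∧
      ∀ i, (s i).Near (c i) (α i) (1 / ((n : ℝ) + 1))
  · obtain ⟨r, hr, hrlen⟩ := exists_seq_of_forall _ hex
    obtain ⟨L, -, ψ, hψ, hL⟩ := (isCompact_univ (X := unitInterval)).tendsto_subseq
      (x := fun n => F.toFun (r n)) fun _ => Set.mem_univ _
    refine ⟨L, fun ε hε => ?_⟩
    by_contra! hcon
    obtain ⟨ρ, hρ, hρlen⟩ := exists_seq_of_forall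
      (fun n s => (∀ i, (s i).Near (c i) (α i) (1 / ((n : ℝ) + 1))) ∧ ε ≤ dist (F.toFun s) L)
      fun n N => by
        obtain ⟨s, h1, h2, h3⟩ := hcon (1 / ((n : ℝ) + 1)) (by positivity) N
        exact ⟨s, h1, h2, h3⟩
    have h1 := hF.2 t c α ht hc hα (fun n => r (ψ n)) ρ
      (fun i => convergenceTesting_of_near (hδ.comp hψ.tendsto_atTop)
        (fun n => strictMono_nat_of_lt_succ (hrlen i) (hψ (Nat.lt_succ_self n)))
        fun n => hr (ψ n) i)
      (fun i => convergenceTesting_of_near hδ (hρlen i) fun n => (hρ n).1 i)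
    have h2 : Tendsto (fun n => dist (F.toFun (r (ψ n))) L) atTop (𝓝 0) :=
      tendsto_iff_dist_tendsto_zero.1 hL
    have h3 := h1.add h2
    rw [add_zero] at h3
    refine absurd (ge_of_tendsto' h3 fun n => ?_) (not_le.2 hε)
    refine (hρ n).2.trans ((dist_triangle _ (F.toFun (r (ψ n))) _).trans (le_of_eq ?_))
    rw [dist_comm, Subtype.dist_eq, Real.dist_eq]
  -- No long tuples are near the parameters, so the claim is vacuous and `0` is an arbitrary choice.
  · push Not at hex
    obtain ⟨n, N, h⟩ := hex
    refine ⟨0, fun ε _ => ⟨1 / ((n : ℝ) + 1), by positivity, N, fun s h1 h2 => ?_⟩⟩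
    obtain ⟨i, hi⟩ := h s h1
    exact (hi (h2 i)).elim

theorem AggFun.Admissible.continuousAt_singleton {k : ℕ} {F : AggFun k} (hF : F.Admissible)
    (u : Fin k → unitInterval) : ∀ ε > 0, ∃ δ > 0, ∀ v : Fin k → unitInterval,
      (∀ i, dist (v i) (u i) < δ) →
      dist (F.toFun fun i => ⟨[v i], by simp⟩) (F.toFun fun i => ⟨[u i], by simp⟩) < ε := by
  intro ε hε
  have hcont := hF.1 fun _ => 0
  have hcont' : Continuous fun v : Fin k → unitInterval =>
      F.toFun fun i => UnitSeq.ofFn (n := 0) fun _ => v i :=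
    hcont.comp (continuous_pi fun i => continuous_pi fun _ => continuous_apply i)
  obtain ⟨δ, hδ, h⟩ := Metric.continuous_iff.1 hcont' u ε hε
  refine ⟨δ, hδ, fun v hv => ?_⟩
  have := h v ((dist_pi_lt_iff hδ).2 hv)
  simpa [UnitSeq.ofFn] using this

end Admissible

/-! ### Realizers of an equality description as tuples of new elements. -/

section Realizers

theorem append_comp_normalForm {l m q : ℕ} {π : Fin (l + m) → Fin (l + q)}
    (hπ : ∀ i, π (Fin.castAdd m i) = Fin.castAdd q i) {D : Type} (a : Fin l → D) (b : Fin q → D) :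
    Fin.append a (fun j => Fin.append a b (π (Fin.natAdd l j))) = Fin.append a b ∘ π := by
  funext z
  refine Fin.addCases (fun i => ?_) (fun j => ?_) z
  · simp [hπ]
  · simp

/-- A description `p` of the equalities between variables is compatible with the equalities between
the first `l` variables if it induces them; in this case the realizers of `p` correspond to
the tuples of new elements, with one entry for each class without one of the first `l` variables. -/
theorem exists_normalForm {l m : ℕ} (p : Setoid (Fin (l + m))) :
    ∃ (q : ℕ) (π : Fin (l + m) → Fin (l + q)), (∀ i, π (Fin.castAdd m i) = Fin.castAdd q i) ∧
      ∀ {D : Type} [Fintype D] (a : Fin l → D),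
        (∀ i j, a i = a j ↔ p (Fin.castAdd m i) (Fin.castAdd m j)) →
        Set.BijOn (fun b : Fin q → D => fun j => Fin.append a b (π (Fin.natAdd l j)))
          {b | IsNew a b} (realizers p a) := by
  classical
  let N := {x : Quotient p // ∀ i : Fin l, Quotient.mk p (Fin.castAdd m i) ≠ x}
  have : Fintype N := Fintype.ofFinite N
  let E : N ≃ Fin (Fintype.card N) := Fintype.equivFin N
  -- A bound variable goes to some free variable that `p` equates with it, and otherwise to the slot
  -- of its class in `N`.
  let π : Fin (l + m) → Fin (l + Fintype.card N) := Fin.append (fun i => Fin.castAdd _ i) fun j =>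
    if h : ∃ i : Fin l, Quotient.mk p (Fin.castAdd m i) = Quotient.mk p (Fin.natAdd l j) then
      Fin.castAdd _ h.choose
    else Fin.natAdd l (E ⟨Quotient.mk p (Fin.natAdd l j), not_exists.1 h⟩)
  have hπl : ∀ i, π (Fin.castAdd m i) = Fin.castAdd _ i := fun i => by simp [π]
  -- Every variable is an old one up to `p`, or represents a new class.
  have hπ : ∀ z, (∃ i, π z = Fin.castAdd _ i ∧ Quotient.mk p (Fin.castAdd m i) = Quotient.mk p z) ∨
      ∃ x : N, π z = Fin.natAdd l (E x) ∧ x.1 = Quotient.mk p z := by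
    intro z
    refine Fin.addCases (fun i => Or.inl ⟨i, hπl i, rfl⟩) (fun j => ?_) z
    by_cases h : ∃ i : Fin l, Quotient.mk p (Fin.castAdd m i) = Quotient.mk p (Fin.natAdd l j)
    · exact Or.inl ⟨h.choose, by simp only [π, Fin.append_right, dif_pos h], h.choose_spec⟩
    · exact Or.inr ⟨_, by simp only [π, Fin.append_right, dif_neg h]; rfl, rfl⟩
  have hold : ∀ x : N, ∃ j : Fin m, Quotient.mk p (Fin.natAdd l j) = x.1 := by
    rintro ⟨x, hx⟩
    induction x using Quotient.inductionOn with | h z =>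
    revert hx
    refine Fin.addCases (fun i hx => (hx i rfl).elim) (fun j _ => ⟨j, rfl⟩) z
  have hπnew : ∀ (x : N) z, Quotient.mk p z = x.1 → π z = Fin.natAdd l (E x) := by
    intro x z hz
    rcases hπ z with ⟨i, -, h2⟩ | ⟨y, h1, h2⟩
    · exact (x.2 i (h2.trans hz)).elim
    · rw [h1, Subtype.ext (h2.trans hz)]
  refine ⟨Fintype.card N, π, hπl, fun {D} _ a ha => ⟨fun b hb => ?_, fun b hb b' hb' h => ?_,
    fun b hb => ?_⟩⟩
  · have happ := append_comp_normalForm hπl a b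
    simp only [realizers, Finset.coe_filter, Finset.mem_univ, true_and, Set.mem_ofPred_eq, happ,
      Function.comp_apply]
    have hpq : ∀ y z, p y z ↔ Quotient.mk p y = Quotient.mk p z := fun y z => Quotient.eq.symm
    intro y z
    rw [hpq]
    rcases hπ y with ⟨i, hi1, hi2⟩ | ⟨x, hx1, hx2⟩ <;>
      rcases hπ z with ⟨i', hi1', hi2'⟩ | ⟨x', hx1', hx2'⟩
    · rw [hi1, hi1', Fin.append_left, Fin.append_left, ha, hpq, hi2, hi2']
    · rw [hi1, hx1', Fin.append_left, Fin.append_right, ← hi2, ← hx2']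
      exact iff_of_false (hb.2 _ _) (x'.2 i)
    · rw [hx1, hi1', Fin.append_left, Fin.append_right, ← hi2', ← hx2]
      exact iff_of_false (hb.2 _ _).symm (x.2 i').symm
    · rw [hx1, hx1', Fin.append_right, Fin.append_right, hb.1.eq_iff, E.apply_eq_iff_eq, ← hx2,
        ← hx2', Subtype.ext_iff]
  · funext y
    obtain ⟨x, rfl⟩ := E.surjective y
    obtain ⟨j, hj⟩ := hold x
    have := congrFun h j
    simpa only [hπnew x _ hj, Fin.append_right] using this
  · simp only [realizers, Finset.coe_filter, Finset.mem_univ, true_and, Set.mem_ofPred_eq] at hb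
    have hpq : ∀ y z, Fin.append a b y = Fin.append a b z ↔ Quotient.mk p y = Quotient.mk p z :=
      fun y z => (hb y z).trans Quotient.eq.symm
    choose rep hrep using hold
    let b' : Fin (Fintype.card N) → D := fun y => b (rep (E.symm y))
    have hb' : ∀ y, b' y = Fin.append a b (Fin.natAdd l (rep (E.symm y))) := fun y => by simp [b']
    refine ⟨b', ⟨fun y y' h => ?_, fun i y h => ?_⟩, ?_⟩
    · rw [hb', hb', hpq, hrep, hrep] at h
      exact E.symm.injective (Subtype.ext h)
    · rw [hb', ← Fin.append_left a b, hpq, hrep] at h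
      exact (E.symm y).2 i h
    · funext j
      rcases hπ (Fin.natAdd l j) with ⟨i, h1, h2⟩ | ⟨x, h1, h2⟩
      · beta_reduce
        rw [h1, Fin.append_left, ← Fin.append_left a b i, ← Fin.append_right a b j, hpq, h2]
      · beta_reduce
        rw [h1, Fin.append_right, hb', ← Fin.append_right a b j, hpq, hrep,
          Equiv.symm_apply_apply, h2]

theorem realizers_eq_empty {l m : ℕ} {p : Setoid (Fin (l + m))} {D : Type} [Fintype D]
    {a : Fin l → D} (h : ¬ ∀ i j, a i = a j ↔ p (Fin.castAdd m i) (Fin.castAdd m j)) :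
    realizers p a = ∅ := by
  classical
  refine Finset.eq_empty_of_forall_notMem fun b hb => h fun i j => ?_
  have := (Finset.mem_filter.1 hb).2 (Fin.castAdd m i) (Fin.castAdd m j)
  simpa using this

end Realizers

/-! ### Aggregations: counting realizers, and the case of a single realizer. -/

section Elimination

/-- The value of an aggregation of the functions `W i` over the realizers of `p`. -/
noncomputable def aggValue {k l m : ℕ} (F : AggFun k) (e : unitInterval) (p : Setoid (Fin (l + m)))
    {D : Type} [Fintype D] (W : Fin k → (Fin (l + m) → D) → unitInterval) (a : Fin l → D) :
    unitInterval :=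
  open Classical in
  if h : (realizers p a).Nonempty then
    F.toFun fun i => ⟨(realizers p a).toList.map (fun b => W i (Fin.append a b)), by
      simpa [List.map_eq_nil_iff, Finset.toList_eq_nil] using h.ne_empty⟩
  else e

theorem aggValue_of_eq_empty {k l m : ℕ} (F : AggFun k) (e : unitInterval)
    {p : Setoid (Fin (l + m))} {D : Type} [Fintype D]
    (W : Fin k → (Fin (l + m) → D) → unitInterval) {a : Fin l → D} (h : realizers p a = ∅) :
    aggValue F e p W a = e :=
  dif_neg (by simp [h])

open Classical in
theorem card_filter_realizers {l m q : ℕ} {p : Setoid (Fin (l + m))} {D : Type} [Fintype D]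
    {a : Fin l → D} {Φ : (Fin q → D) → Fin m → D}
    (h : Set.BijOn Φ {b | IsNew a b} (realizers p a)) (Q : (Fin m → D) → Prop) :
    (((realizers p a).filter Q).card : ℝ) =
      ∑ b : Fin q → D, if IsNew a b ∧ Q (Φ b) then 1 else 0 := by
  rw [Finset.sum_boole]
  congr 1
  refine (Finset.card_nbij Φ ?_ ?_ ?_).symm
  · intro b hb
    obtain ⟨-, hb⟩ := Finset.mem_filter.1 hb
    exact Finset.mem_filter.2 ⟨h.mapsTo hb.1, hb.2⟩
  · intro b hb b' hb' hbb
    rw [Finset.mem_coe, Finset.mem_filter] at hb hb'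
    exact h.injOn hb.2.1 hb'.2.1 hbb
  · intro b hb
    rw [Finset.mem_coe, Finset.mem_filter] at hb
    obtain ⟨b', h1, rfl⟩ := h.surjOn hb.1
    exact ⟨b', by simpa using ⟨h1, hb.2⟩, rfl⟩

theorem countP_toList {β : Type*} (s : Finset β) (Q : β → Prop) [DecidablePred Q] :
    s.toList.countP (fun b => Q b) = (s.filter Q).card := by
  rw [← Multiset.coe_countP, Finset.coe_toList, Multiset.countP_eq_card_filter]
  rfl

/-- The difference equals `((x - a) * b - a * (y - b)) / (y * b)`. The bound `b / 2` gives `y * b ≥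
b ^ 2 / 2`, and the other one makes the numerator at most `δ * b ^ 2 / 4`. -/
theorem abs_div_sub_div_lt {x y a b δ : ℝ} (hδ : 0 < δ) (ha0 : 0 ≤ a) (ha1 : a ≤ 1) (hb0 : 0 < b)
    (hb1 : b ≤ 1) (hx : |x - a| ≤ min (b / 2) (δ * b ^ 2 / 8))
    (hy : |y - b| ≤ min (b / 2) (δ * b ^ 2 / 8)) : |x / y - a / b| < δ := by
  have hyb : b / 2 ≤ y := by linarith [(abs_le.1 (hy.trans (min_le_left _ _))).1]
  have hy0 : 0 < y := by linarith
  have hx' := hx.trans (min_le_right _ _)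
  have hy' := hy.trans (min_le_right _ _)
  have heq : x / y - a / b = ((x - a) * b - a * (y - b)) / (y * b) := by
    field_simp
    ring
  rw [heq, abs_div, abs_of_pos (mul_pos hy0 hb0), div_lt_iff₀ (mul_pos hy0 hb0)]
  have h1 : |(x - a) * b| ≤ δ * b ^ 2 / 8 := by
    rw [abs_mul, abs_of_pos hb0]
    exact (mul_le_of_le_one_right (abs_nonneg _) hb1).trans hx'
  have h2 : |a * (y - b)| ≤ δ * b ^ 2 / 8 := by
    rw [abs_mul, abs_of_nonneg ha0]
    exact (mul_le_of_le_one_left (abs_nonneg _) ha1).trans hy'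
  have h3 : δ * b ^ 2 / 2 ≤ δ * (y * b) := by
    nlinarith [mul_le_mul_of_nonneg_left hyb (mul_pos hδ hb0).le]
  have h4 : 0 < δ * b ^ 2 := by positivity
  have := abs_sub ((x - a) * b) (a * (y - b))
  linarith

variable {ι : Type u} [Fintype ι] {ar : ι → ℕ} {G : Network ar} {e : unitInterval}

/-- With high probability, the values `V n A a` are uniformly close to `f (tp A a)`. -/
def Network.Approx (G : Network ar) (e : unitInterval) {d : ℕ}
    (V : ∀ n, Struct ar (Fin n) → (Fin d → Fin n) → unitInterval) (f : AType ar d → unitInterval) :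
    Prop :=
  ∀ ε > 0, G.Whp e fun n => {A | ∀ a, dist (V n A a) (f (tp A a)) < ε}

namespace Network

theorem approx_of_forall_type {d : ℕ}
    {V : ∀ n, Struct ar (Fin n) → (Fin d → Fin n) → unitInterval} {f : AType ar d → unitInterval}
    (h : ∀ t, ∀ ε > 0, G.Whp e fun n => {A | ∀ a, tp A a = t → dist (V n A a) (f t) < ε}) :
    G.Approx e V f := fun ε hε => by
  refine (Whp.iInter fun t => h t ε hε).mono (Eventually.of_forall fun n A hA a => ?_)
  exact Set.mem_iInter.1 hA (tp A a) a rfl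

/-- Every bound variable equals a free one, so the aggregated sequences have length one. Condition
(2) of admissibility says nothing here, and continuity is used instead. -/
theorem exists_approx_agg_zero {k l m : ℕ} {F : AggFun k} (hF : F.Admissible)
    {V : Fin k → ∀ n, Struct ar (Fin n) → (Fin (l + m) → Fin n) → unitInterval}
    {f : Fin k → AType ar (l + m) → unitInterval} (hV : ∀ i, G.Approx e (V i) (f i))
    {p : Setoid (Fin (l + m))} {π : Fin (l + m) → Fin l}
    (hπ : ∀ i, π (Fin.castAdd m i) = i)
    (hbij : ∀ {D : Type} [Fintype D] (a : Fin l → D),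
      (∀ i j, a i = a j ↔ p (Fin.castAdd m i) (Fin.castAdd m j)) →
      realizers p a = {fun j => a (π (Fin.natAdd l j))}) :
    ∃ f' : AType ar l → unitInterval,
      G.Approx e (fun n A a => aggValue F e p (fun i => V i n A) a) f' := by
  classical
  refine ⟨fun t => if ∀ i j, t.1 i j ↔ p (Fin.castAdd m i) (Fin.castAdd m j) then
    F.toFun fun i => ⟨[f i (t.comap π)], by simp⟩ else e, approx_of_forall_type fun t ε hε => ?_⟩
  obtain ⟨δ, hδ, h⟩ := hF.continuousAt_singleton (fun i => f i (t.comap π)) ε hε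
  refine (Whp.iInter fun i => hV i δ hδ).mono (Eventually.of_forall fun n A hA a ha => ?_)
  rw [Set.mem_iInter] at hA
  have hcompat : (∀ i j, t.1 i j ↔ p (Fin.castAdd m i) (Fin.castAdd m j)) ↔
      ∀ i j, a i = a j ↔ p (Fin.castAdd m i) (Fin.castAdd m j) := by rw [← ha]; rfl
  by_cases hc : ∀ i j, t.1 i j ↔ p (Fin.castAdd m i) (Fin.castAdd m j)
  · have hr := hbij a (hcompat.1 hc)
    rw [if_pos hc, aggValue, dif_pos (by simp [hr])]
    have happ : Fin.append a (fun j => a (π (Fin.natAdd l j))) = a ∘ π := by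
      funext z
      refine Fin.addCases (fun i => ?_) (fun j => ?_) z
      · simp [hπ]
      · simp
    have := h (fun i => V i n A (a ∘ π)) fun i => by
      have := hA i (a ∘ π)
      rwa [tp_comp, ha] at this
    convert this using 4 with i
    refine Subtype.ext ?_
    change (realizers p a).toList.map _ = [_]
    rw [hr, Finset.toList_singleton, List.map_singleton, happ]
  · rw [if_neg hc, aggValue_of_eq_empty _ _ _ (realizers_eq_empty (mt hcompat.2 hc)), dist_self]
    exact hε

end Network
end Elimination

/-! ### Aggregations over a growing number of realizers. -/

section Elimination

/-- The types of tuples whose last `q` entries are distinct and do not occur among the first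
ones. -/
def AType.IsNew {ι : Type u} {ar : ι → ℕ} {l q : ℕ} (t : AType ar (l + q)) : Prop :=
  (∀ j j', t.1 (Fin.natAdd l j) (Fin.natAdd l j') → j = j') ∧
    ∀ i j, ¬ t.1 (Fin.castAdd q i) (Fin.natAdd l j)

theorem isNew_tp_append {ι : Type u} {ar : ι → ℕ} {D : Type} (A : Struct ar D)
    {l q : ℕ} (a : Fin l → D) (b : Fin q → D) :
    (tp A (Fin.append a b)).IsNew ↔ IsNew a b := by
  simp only [AType.IsNew, ker_iff_tp, Fin.append_left, Fin.append_right, IsNew, Function.Injective]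

variable {ι : Type u} [Fintype ι] {ar : ι → ℕ} {G : Network ar} {e : unitInterval}

namespace Network

/-- There are about `hnew * n ^ q` realizers, of which about `h i v * n ^ q` have an `i`-th value
close to `v`. So the sequences are near the values of positive frequency, in proportions `h i v /
hnew`, and `exists_limit` applies. -/
theorem approx_agg_type {k l m q : ℕ} {F : AggFun k} (hF : F.Admissible) (hq : 0 < q)
    {V : Fin k → ∀ n, Struct ar (Fin n) → (Fin (l + m) → Fin n) → unitInterval}
    {f : Fin k → AType ar (l + m) → unitInterval} (hV : ∀ i, G.Approx e (V i) (f i))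
    {p : Setoid (Fin (l + m))} (t : AType ar l)
    {hnew : ℝ} (hnew0 : 0 < hnew) (hnew1 : hnew ≤ 1)
    (hlln : ∀ ε > 0, G.Whp e fun n => {A | ∀ a : Fin l → Fin n, tp A a = t →
      |((realizers p a).card : ℝ) / (n : ℝ) ^ q - hnew| ≤ ε})
    {h : Fin k → unitInterval → ℝ} (h0 : ∀ i v, 0 ≤ h i v) (h1 : ∀ i v, h i v ≤ 1)
    (hfreq : ∀ i v, ∀ ε > 0, G.Whp e fun n => {A | ∀ a : Fin l → Fin n, tp A a = t →
      |((open Classical in (realizers p a).filter fun b =>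
        f i (tp A (Fin.append a b)) = v).card : ℝ) / (n : ℝ) ^ q - h i v| ≤ ε})
    (hzero : ∀ i v, h i v = 0 → G.Whp e fun n => {A | ∀ a : Fin l → Fin n, tp A a = t →
      ∀ b ∈ realizers p a, f i (tp A (Fin.append a b)) ≠ v})
    (hpos : ∀ i, ∃ s, 0 < h i (f i s)) :
    ∃ L : unitInterval, ∀ ε > 0, G.Whp e fun n => {A | ∀ a : Fin l → Fin n, tp A a = t →
      dist (aggValue F e p (fun i => V i n A) a) L < ε} := by
  classical
  let S : Fin k → Finset unitInterval := fun i =>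
    (Set.finite_range (f i)).toFinset.filter fun v => 0 < h i v
  have hS : ∀ i v, v ∈ S i ↔ v ∈ Set.range (f i) ∧ 0 < h i v := fun i v => by simp [S]
  have hSne : ∀ i, 0 < (S i).card := fun i => by
    obtain ⟨s, hs⟩ := hpos i
    exact Finset.card_pos.2 ⟨f i s, (hS i _).2 ⟨⟨s, rfl⟩, hs⟩⟩
  let c : (i : Fin k) → Fin (S i).card → unitInterval := fun i j => ((S i).equivFin.symm j).1
  have hcS : ∀ i j, c i j ∈ S i := fun i j => ((S i).equivFin.symm j).2
  -- The label `0` outside `S i` is a default that no realizer receives.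
  let lab : (i : Fin k) → unitInterval → Fin (S i).card := fun i v =>
    if hv : v ∈ S i then (S i).equivFin ⟨v, hv⟩ else ⟨0, hSne i⟩
  have hlab : ∀ i v, v ∈ S i → c i (lab i v) = v := fun i v hv => by simp [c, lab, hv]
  have hc : ∀ i, Function.Injective (c i) := fun i =>
    Subtype.val_injective.comp (S i).equivFin.symm.injective
  -- Projecting to `[0,1]` avoids a proof of `h i v ≤ hnew`: the actual proportions lie in `[0,1]`,
  -- and the projection does not increase distances.
  let α : (i : Fin k) → Fin (S i).card → unitInterval := fun i j =>
    Set.projIcc 0 1 zero_le_one (h i (c i j) / hnew)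
  have hα : ∀ i j, 0 < α i j := fun i j => by
    have hr : 0 < h i (c i j) / hnew := div_pos ((hS i _).1 (hcS i j)).2 hnew0
    rw [← Subtype.coe_lt_coe, Set.coe_projIcc]
    exact lt_max_of_lt_right (lt_min one_pos hr)
  obtain ⟨L, hL⟩ := hF.exists_limit (fun i => (S i).card) c α hSne hc hα
  refine ⟨L, fun ε hε => ?_⟩
  obtain ⟨δ, hδ, N, hN⟩ := hL ε hε
  set η := min (hnew / 2) (δ * hnew ^ 2 / 8)
  have hη : 0 < η := by positivity
  have hW := ((Whp.iInter fun i => hV i δ hδ).inter (hlln η hη)).inter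
    ((Whp.iInter fun x : Σ i, Fin (S i).card => hfreq x.1 (c x.1 x.2) η hη).inter
      (Whp.iInter fun x : Σ i, {v : Set.range (f i) // h i v = 0} => hzero x.1 x.2.1 x.2.2))
  refine hW.mono ?_
  -- This bound makes `hnew / 2 * n ^ q ≥ N`, as `q > 0`, so there are at least `N` realizers.
  filter_upwards [eventually_ge_atTop (⌈N / (hnew / 2)⌉₊ + 1)] with n hn A hA a ha
  simp only [Set.mem_inter_iff, Set.mem_iInter, Set.mem_ofPred_eq] at hA
  obtain ⟨⟨hA1, hA2⟩, hA3, hA4⟩ := hA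
  have hn1 : (1 : ℝ) ≤ n := by exact_mod_cast (by omega : 1 ≤ n)
  have hcard := hA2 a ha
  have hlarge : (N : ℝ) ≤ (realizers p a).card := by
    have h2 : hnew / 2 ≤ (realizers p a).card / (n : ℝ) ^ q := by
      linarith [(abs_le.1 (hcard.trans (min_le_left _ _))).1]
    rw [le_div_iff₀ (by positivity)] at h2
    have h3 : (N : ℝ) ≤ hnew / 2 * n := by
      have : (N : ℝ) / (hnew / 2) ≤ n := (Nat.le_ceil _).trans (by exact_mod_cast (by omega))
      rwa [div_le_iff₀ (by positivity), mul_comm] at this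
    have h4 : (n : ℝ) ≤ (n : ℝ) ^ q := le_self_pow₀ hn1 hq.ne'
    nlinarith
  have hne : (realizers p a).Nonempty := by
    by_contra hemp
    rw [Finset.not_nonempty_iff_eq_empty] at hemp
    rw [hemp, Finset.card_empty, Nat.cast_zero, zero_div, zero_sub, abs_neg, abs_of_pos hnew0]
      at hcard
    linarith [hcard.trans (min_le_left _ _)]
  have hmem : ∀ i, ∀ b ∈ realizers p a, f i (tp A (Fin.append a b)) ∈ S i := fun i b hb => by
    refine (hS i _).2 ⟨⟨_, rfl⟩, lt_of_le_of_ne (h0 i _) fun hz => ?_⟩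
    exact hA4 ⟨i, ⟨⟨_, ⟨_, rfl⟩⟩, hz.symm⟩⟩ a ha b hb rfl
  rw [aggValue, dif_pos hne]
  refine hN _ (fun i => ?_) fun i => ?_
  · simpa using (by exact_mod_cast hlarge : N ≤ (realizers p a).card)
  · refine ⟨(realizers p a).toList.map fun b =>
      (V i n A (Fin.append a b), lab i (f i (tp A (Fin.append a b)))), ?_, ?_, fun j => ?_⟩
    · rw [List.map_map]
      rfl
    · intro x hx
      obtain ⟨b, hb, rfl⟩ := List.mem_map.1 hx
      rw [hlab i _ (hmem i b (Finset.mem_toList.1 hb))]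
      exact hA1 i _
    · rw [List.countP_map, List.length_map, Finset.length_toList]
      have hcount : (realizers p a).toList.countP
          ((fun x : unitInterval × Fin (S i).card => decide (x.2 = j)) ∘ fun b =>
            (V i n A (Fin.append a b), lab i (f i (tp A (Fin.append a b))))) =
          ((realizers p a).filter fun b => f i (tp A (Fin.append a b)) = c i j).card := by
        refine Eq.trans ?_ (countP_toList _ _)
        refine List.countP_congr fun b hb => ?_
        have := hlab i _ (hmem i b (Finset.mem_toList.1 hb))
        simp only [Function.comp_apply, decide_eq_true_eq]
        constructor
        · rintro rfl; exact this.symm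
        · intro h; exact hc i (this.trans h)
      rw [hcount]
      have hfr := hA3 ⟨i, j⟩ a ha
      have hlt := abs_div_sub_div_lt hδ (h0 i _) (h1 i _) hnew0 hnew1 hfr hcard
      rw [div_div_div_cancel_right₀ (by positivity)] at hlt
      refine lt_of_le_of_lt ?_ hlt
      set x : ℝ := ((realizers p a).filter fun b => f i (tp A (Fin.append a b)) = c i j).card /
        (realizers p a).card with hx
      have hx01 : x ∈ Set.Icc (0 : ℝ) 1 := ⟨by positivity, div_le_one_of_le₀
        (by exact_mod_cast Finset.card_filter_le _ _) (by positivity)⟩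
      have hproj : x = (Set.projIcc (0 : ℝ) 1 zero_le_one x : ℝ) := by
        rw [Set.projIcc_of_mem _ hx01]
      conv_lhs => rw [hproj]
      exact Set.abs_projIcc_sub_projIcc zero_le_one

/-- For a fixed type there are either no realizers, with high probability, and the limit is `e`, or
their number grows like `n ^ q`; `q = 0` is the case of a single realizer. -/
theorem exists_approx_agg {k l m : ℕ} (hG : ∀ R, (G.formula R).AggFree)
    {F : AggFun k} (hF : F.Admissible)
    {V : Fin k → ∀ n, Struct ar (Fin n) → (Fin (l + m) → Fin n) → unitInterval}
    {f : Fin k → AType ar (l + m) → unitInterval} (hV : ∀ i, G.Approx e (V i) (f i))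
    (p : Setoid (Fin (l + m))) :
    ∃ f' : AType ar l → unitInterval,
      G.Approx e (fun n A a => aggValue F e p (fun i => V i n A) a) f' := by
  classical
  obtain ⟨q, π, hπ, hbij⟩ := exists_normalForm p
  rcases Nat.eq_zero_or_pos q with rfl | hq
  · refine exists_approx_agg_zero hF hV (π := π) hπ fun {D} _ a ha => ?_
    have hb := hbij a ha
    have happ : ∀ b : Fin 0 → D, Fin.append a b = a := fun b => by
      rw [Subsingleton.elim b Fin.elim0, Fin.append_elim0]; rfl
    ext b
    rw [← Finset.mem_coe, ← hb.image_eq, Finset.mem_singleton]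
    constructor
    · rintro ⟨b', -, rfl⟩
      funext j
      beta_reduce
      rw [happ]
    · rintro rfl
      refine ⟨Fin.elim0, ⟨fun i => i.elim0, fun _ j => j.elim0⟩, ?_⟩
      funext j
      beta_reduce
      rw [happ]
  suffices h : ∀ t : AType ar l, ∃ L : unitInterval, ∀ ε > 0, G.Whp e fun n =>
      {A | ∀ a : Fin l → Fin n, tp A a = t →
        dist (aggValue F e p (fun i => V i n A) a) L < ε} by
    choose f' hf' using h
    exact ⟨f', approx_of_forall_type hf'⟩
  intro t
  have hempty : (G.Whp e fun n => {A | ∀ a : Fin l → Fin n, tp A a = t → realizers p a = ∅}) →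
      ∃ L : unitInterval, ∀ ε > 0, G.Whp e fun n => {A | ∀ a : Fin l → Fin n, tp A a = t →
        dist (aggValue F e p (fun i => V i n A) a) L < ε} := fun h =>
    ⟨e, fun ε hε => h.mono (Eventually.of_forall fun n A hA a ha => by
      rw [aggValue_of_eq_empty _ _ _ (hA a ha), dist_self]; exact hε)⟩
  have hcompat_iff : ∀ {n : ℕ} {A : Struct ar (Fin n)} {a : Fin l → Fin n}, tp A a = t →
      ((∀ i j, t.1 i j ↔ p (Fin.castAdd m i) (Fin.castAdd m j)) ↔
        ∀ i j, a i = a j ↔ p (Fin.castAdd m i) (Fin.castAdd m j)) := by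
    rintro n A a rfl
    rfl
  by_cases hcompat : ∀ i j, t.1 i j ↔ p (Fin.castAdd m i) (Fin.castAdd m j)
  swap
  · exact hempty (whp_univ.mono (Eventually.of_forall fun n A _ a ha =>
      realizers_eq_empty (mt (hcompat_iff ha).2 hcompat)))
  have htp : ∀ {n : ℕ} (A : Struct ar (Fin n)) (a : Fin l → Fin n) (b : Fin q → Fin n),
      tp A (Fin.append a fun j => Fin.append a b (π (Fin.natAdd l j))) =
        (tp A (Fin.append a b)).comap π := fun A a b => by
    rw [append_comp_normalForm hπ, tp_comp]
  -- The law of large numbers is applied to the indicator of new `q`-tuples whose image under `π`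
  -- satisfies `Q`.
  have key : ∀ Q : AType ar (l + m) → Prop, ∃ h : ℝ, 0 ≤ h ∧ h ≤ 1 ∧
      (∀ ε > 0, G.Whp e fun n => {A | ∀ a : Fin l → Fin n, tp A a = t →
        |(((realizers p a).filter fun b => Q (tp A (Fin.append a b))).card : ℝ) / (n : ℝ) ^ q - h|
          ≤ ε}) ∧
      (h = 0 → G.Whp e fun n => {A | ∀ a : Fin l → Fin n, tp A a = t →
        ∀ b ∈ realizers p a, ¬ Q (tp A (Fin.append a b))}) := by
    intro Q
    obtain ⟨h, h0, h1, h2, h3⟩ := exists_extMean (e := e) hG l q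
      (fun s : AType ar (l + q) => if s.IsNew ∧ Q (s.comap π) then 1 else 0)
      (fun s => by split_ifs <;> norm_num) (fun s => by split_ifs <;> norm_num)
    refine ⟨h t, h0 t, h1 t, fun ε hε => ?_, fun hz => ?_⟩
    · refine (h2 ε hε).mono (Eventually.of_forall fun n A hA a ha => ?_)
      have := hA a
      rw [ha] at this
      rw [card_filter_realizers (hbij a ((hcompat_iff ha).1 hcompat))]
      simpa only [isNew_tp_append, htp] using this
    · refine h3.mono (Eventually.of_forall fun n A hA a ha b hb hQ => ?_)
      obtain ⟨b', hb', rfl⟩ := (hbij a ((hcompat_iff ha).1 hcompat)).surjOn hb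
      have := hA a b' hb' (by rw [ha, hz])
      rw [htp] at hQ
      rw [if_pos ⟨(isNew_tp_append A a b').2 hb', hQ⟩] at this
      exact one_ne_zero this
  obtain ⟨hnew, hnew0, hnew1, hlln, hnewz⟩ := key fun _ => True
  simp only [Finset.filter_true, not_true, imp_false] at hlln hnewz
  rcases hnew0.eq_or_lt with hz | hnew0
  · exact hempty ((hnewz hz.symm).mono (Eventually.of_forall fun n A hA a ha =>
      Finset.eq_empty_of_forall_notMem (hA a ha)))
  choose h h0 h1 hfreq hzero using fun (i : Fin k) (v : unitInterval) => key fun s => f i s = v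
  by_cases hpos : ∀ i, ∃ s, 0 < h i (f i s)
  · exact approx_agg_type hF hq hV t hnew0 hnew1 hlln h0 h1
      (fun i v ε hε => by convert hfreq i v ε hε) hzero hpos
  · push Not at hpos
    obtain ⟨i, hi⟩ := hpos
    refine hempty ((Whp.iInter fun s => hzero i (f i s) ((hi s).antisymm (h0 i _))).mono
      (Eventually.of_forall fun n A hA a ha => Finset.eq_empty_of_forall_notMem fun b hb => ?_))
    exact Set.mem_iInter.1 hA (tp A (Fin.append a b)) a ha b hb rfl

end Network
end Elimination

/-! ### Elimination of aggregation functions, and convergence. -/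

section Main

theorem continuous_lukImp : Continuous fun x : unitInterval × unitInterval × unitInterval =>
    lukImp x.1 x.2.1 := by
  unfold lukImp
  fun_prop

theorem continuous_wMean : Continuous fun x : unitInterval × unitInterval × unitInterval =>
    wMean x.1 x.2.1 x.2.2 := by
  unfold wMean
  fun_prop

variable {ι : Type u} [Fintype ι] {ar : ι → ℕ} {G : Network ar} {e : unitInterval}

namespace Network

theorem approx_of_eq {d : ℕ}
    {V : ∀ n, Struct ar (Fin n) → (Fin d → Fin n) → unitInterval} {f : AType ar d → unitInterval}
    (h : ∀ n A a, V n A a = f (tp A a)) : G.Approx e V f := fun ε hε =>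
  whp_univ.mono (Eventually.of_forall fun n A _ a => by rw [h, dist_self]; exact hε)

/-- The cube is compact, so `o` is uniformly continuous. Three arguments serve all connectives;
those with fewer ignore the rest. -/
theorem Approx.comp {d : ℕ}
    {V V' V'' : ∀ n, Struct ar (Fin n) → (Fin d → Fin n) → unitInterval}
    {f f' f'' : AType ar d → unitInterval} (h : G.Approx e V f) (h' : G.Approx e V' f')
    (h'' : G.Approx e V'' f'') (o : unitInterval × unitInterval × unitInterval → unitInterval)
    (ho : Continuous o) :
    G.Approx e (fun n A a => o (V n A a, V' n A a, V'' n A a))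
      (fun t => o (f t, f' t, f'' t)) := fun ε hε => by
  obtain ⟨δ, hδ, hu⟩ := Metric.uniformContinuous_iff.1
    (CompactSpace.uniformContinuous_of_continuous ho) ε hε
  refine ((h δ hδ).inter ((h' δ hδ).inter (h'' δ hδ))).mono
    (Eventually.of_forall fun n A hA a => hu ?_)
  exact max_lt (hA.1 a) (max_lt (hA.2.1 a) (hA.2.2 a))

theorem Approx.reindex {d l : ℕ}
    {V : ∀ n, Struct ar (Fin n) → (Fin l → Fin n) → unitInterval} {f : AType ar l → unitInterval}
    (h : G.Approx e V f) (x : Fin l → Fin d) :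
    G.Approx e (fun n A a => V n A (fun i => a (x i))) (fun t => f (t.comap x)) := fun ε hε =>
  (h ε hε).mono (Eventually.of_forall fun _ _ hA _ => hA _)

/-- Asymptotic elimination of aggregation functions: with high probability, the value of a formula
at a tuple is close to a number determined by the atomic type of the tuple. -/
theorem exists_approx_value (hG : ∀ R, (G.formula R).AggFree) {d : ℕ} (φ : Formula ar d)
    (hφ : φ.OnlyAdmissible) :
    ∃ f : AType ar d → unitInterval, G.Approx e (fun _ A a => φ.value e A a) f := by
  classical
  induction φ with
  | const c => exact ⟨fun _ => c, approx_of_eq fun _ _ _ => by simp only [Formula.value]⟩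
  | eq i j =>
    refine ⟨fun t => if t.1 i j then 1 else 0, approx_of_eq fun n A a => ?_⟩
    simp only [Formula.value]
    simp only [show (tp A a).1 i j ↔ a i = a j from Iff.rfl]
    congr
  | rel R v =>
    refine ⟨fun t => if t.2 R v then 1 else 0, approx_of_eq fun n A a => ?_⟩
    simp only [Formula.value]
    rfl
  | neg φ ih =>
    obtain ⟨f, hf⟩ := ih hφ
    simp only [Formula.value]
    exact ⟨_, hf.comp hf hf (fun x => unitInterval.symm x.1)
      (unitInterval.continuous_symm.comp continuous_fst)⟩
  | and φ ψ ih1 ih2 =>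
    obtain ⟨f, hf⟩ := ih1 hφ.1
    obtain ⟨g, hg⟩ := ih2 hφ.2
    simp only [Formula.value]
    exact ⟨_, hf.comp hg hg (fun x => min x.1 x.2.1) (by fun_prop)⟩
  | or φ ψ ih1 ih2 =>
    obtain ⟨f, hf⟩ := ih1 hφ.1
    obtain ⟨g, hg⟩ := ih2 hφ.2
    simp only [Formula.value]
    exact ⟨_, hf.comp hg hg (fun x => max x.1 x.2.1) (by fun_prop)⟩
  | imp φ ψ ih1 ih2 =>
    obtain ⟨f, hf⟩ := ih1 hφ.1
    obtain ⟨g, hg⟩ := ih2 hφ.2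
    simp only [Formula.value]
    exact ⟨_, hf.comp hg hg (fun x => lukImp x.1 x.2.1) continuous_lukImp⟩
  | mean φ ψ χ ih1 ih2 ih3 =>
    obtain ⟨f, hf⟩ := ih1 hφ.1
    obtain ⟨g, hg⟩ := ih2 hφ.2.1
    obtain ⟨h, hh⟩ := ih3 hφ.2.2
    simp only [Formula.value]
    exact ⟨_, hf.comp hg hh (fun x => wMean x.1 x.2.1 x.2.2) continuous_wMean⟩
  | agg hk F x p φ ih =>
    choose f hf using fun i => ih i (hφ.2 i)
    obtain ⟨f', hf'⟩ := exists_approx_agg hG hφ.1 hf p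
    refine ⟨fun t => f' (t.comap x), ?_⟩
    simp only [Formula.value]
    exact hf'.reindex x

/-- The probability that a tuple has a type in a given set does not depend on the size of the
domain. -/
theorem prob_tp_castAdd (hG : ∀ R, (G.formula R).AggFree) {d m : ℕ} (a : Fin d → Fin m)
    (T : Set (AType ar d)) (s : ℕ) :
    G.prob e (m + s) {A | tp A (fun i => Fin.castAdd s (a i)) ∈ T} =
      G.prob e m {A | tp A a ∈ T} := by
  classical
  rw [prob_eq_avg hG _ _ (fun _ => True), prob_eq_avg hG m _ (fun _ => True)]
  have h : ∀ B : Cell ar (Fin (m + s)) → Prop, tp (toStruct B) (fun i => Fin.castAdd s (a i)) =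
      tp (toStruct (B ∘ mapCell (Fin.castAdd s))) a := fun B =>
    tp_toStruct_comp (Fin.castAdd_injective m s) B a
  simp only [Set.mem_ofPred_eq, h]
  exact avg_comap hG (Fin.castAdd_injective m s) (fun _ => Iff.rfl)
    (fun B => if tp (toStruct B) a ∈ T then 1 else 0) _

/-- The probabilities of events which agree with high probability have the same limits. -/
theorem tendsto_prob_of_whp {m : ℕ} {X Y : ∀ s, Set (Struct ar (Fin (m + s)))} {r : ℝ}
    {Z : ∀ n, Set (Struct ar (Fin n))} (hZ : G.Whp e Z)
    (h : ∀ s, ∀ A ∈ Z (m + s), A ∈ X s ↔ A ∈ Y s)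
    (hY : Tendsto (fun s => G.prob e (m + s) (Y s)) atTop (𝓝 r)) :
    Tendsto (fun s => G.prob e (m + s) (X s)) atTop (𝓝 r) := by
  have h0 : Tendsto (fun s => G.prob e (m + s) (Z (m + s))ᶜ) atTop (𝓝 0) :=
    hZ.comp (tendsto_atTop_mono (fun s => Nat.le_add_left s m) tendsto_id)
  refine tendsto_of_tendsto_of_tendsto_of_le_of_le (by simpa using hY.sub h0)
    (by simpa using hY.add h0) (fun s => ?_) fun s => ?_
  · refine sub_le_iff_le_add.2 ((prob_mono fun A hA => ?_).trans (prob_union_le _ _))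
    by_cases hAZ : A ∈ Z (m + s)
    exacts [Or.inl ((h s A hAZ).2 hA), Or.inr hAZ]
  · refine (prob_mono fun A hA => ?_).trans (prob_union_le _ _)
    by_cases hAZ : A ∈ Z (m + s)
    exacts [Or.inl ((h s A hAZ).1 hA), Or.inr hAZ]

end Network
end Main
end PLA

theorem mainTheorem2 {ι : Type*} [Fintype ι] (ar : ι → ℕ) (G : PLA.Network ar)
    (hG : ∀ R, (G.formula R).AggFree) (e : unitInterval)
    {d : ℕ} (φ : PLA.Formula ar d) (hφ : φ.OnlyAdmissible) :
    ∃ (k : ℕ) (c : Fin k → unitInterval),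
      ∀ m : ℕ, 0 < m → ∀ (a : Fin d → Fin m) (ε : ℝ), 0 < ε →
        Tendsto (fun s : ℕ => G.prob e (m + s)
            {A | ∃ i, (φ.value e A (fun q => Fin.castAdd s (a q)) : ℝ) ∈
              Set.Icc ((c i : ℝ) - ε) ((c i : ℝ) + ε)}) atTop (𝓝 1) ∧
        ∀ i, (∀ j, |(c i : ℝ) - (c j : ℝ)| ≠ ε) →
          ∃ L : ℝ, Tendsto (fun s : ℕ => G.prob e (m + s)
            {A | |(φ.value e A (fun q => Fin.castAdd s (a q)) : ℝ) - (c i : ℝ)| < ε})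
            atTop (𝓝 L) := by
  classical
  obtain ⟨f, hf⟩ := PLA.Network.exists_approx_value (e := e) hG φ hφ
  obtain ⟨k, ⟨E⟩⟩ := Finite.exists_equiv_fin (PLA.AType ar d)
  -- One number for each atomic type, repetitions allowed.
  refine ⟨k, fun i => f (E.symm i), fun m hm a ε hε => ⟨?_, fun i hi => ?_⟩⟩
  · refine PLA.Network.tendsto_prob_of_whp (hf ε hε) (Y := fun _ => Set.univ) (fun s A hA => ?_)
      (by simp only [PLA.Network.prob_univ hG, tendsto_const_nhds])
    refine iff_of_true ⟨E (PLA.tp A fun q => Fin.castAdd s (a q)), ?_⟩ trivial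
    have := abs_lt.1 (hA fun q => Fin.castAdd s (a q))
    simp only [Equiv.symm_apply_apply]
    exact ⟨by linarith [this.1], by linarith [this.2]⟩
  · have : Nonempty (Fin k) := ⟨i⟩
    -- The least gap between `ε` and the distances `|c i - c j|` is positive; an approximation error
    -- below it cannot carry the value across the threshold `ε`.
    obtain ⟨j, hj⟩ := Finite.exists_min fun j =>
      abs (|(f (E.symm i) : ℝ) - f (E.symm j)| - ε)
    refine ⟨_, PLA.Network.tendsto_prob_of_whp (hf _ (abs_pos.2 (sub_ne_zero.2 (hi j))))
      (Y := fun s => {A | PLA.tp A (fun q => Fin.castAdd s (a q)) ∈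
        {t | |(f t : ℝ) - f (E.symm i)| < ε}}) (fun s A hA => ?_)
      (by simp only [PLA.Network.prob_tp_castAdd hG]; exact tendsto_const_nhds)⟩
    have h1 := (hA fun q => Fin.castAdd s (a q)).trans_le
      (hj (E (PLA.tp A fun q => Fin.castAdd s (a q))))
    rw [Equiv.symm_apply_apply, Subtype.dist_eq, Real.dist_eq] at h1
    simp only [Set.mem_ofPred_eq]
    set x : ℝ := ((φ.value e A fun q => Fin.castAdd s (a q) : unitInterval) : ℝ)
    set y : ℝ := ((f (PLA.tp A fun q => Fin.castAdd s (a q)) : unitInterval) : ℝ)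
    set z : ℝ := ((f (E.symm i) : unitInterval) : ℝ)
    rw [abs_sub_comm z y] at h1
    have h2 := abs_sub_le x y z
    have h3 := abs_sub_le y x z
    rw [abs_sub_comm y x] at h3
    rcases le_total 0 (|y - z| - ε) with h | h
    · rw [abs_of_nonneg h] at h1
      exact iff_of_false (by linarith) (by linarith)
    · rw [abs_of_nonpos h] at h1
      have h4 := abs_nonneg (x - y)
      exact iff_of_true (by linarith) (by linarith)
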